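/- **Theorem (DAIG from-scratch consistency).** *Programs.* A program $\langle L,E,\ell_0\rangle$ is a finite control-flow graph with edges $\ell\xrightarrow{s}\ell'$ labelled by statements and with entry $\ell_0$. An edge is a *back edge* if its destination dominates its source, and a *forward edge* otherwise. The program is *well-formed* if $\ell_0\in L$, all edges have endpoints in $L$, the forward edges form an acyclic graph in which every location of $L$ is reachable from $\ell_0$ (the graph is reducible), each location is the destination of at most one back edge, and an edge that leaves a natural loop starts at the head of that loop. Loops may be nested. (The natural loop of the destination $h$ of a back edge, its *head*, consists of $h$ and of all locations from which the source of that edge can be reached without passing through $h$.) A *join location* has at least two incoming forward edges; these are numbered $1,2,\dots$. *Abstract interpreters.* An abstract interpreter $\langle \Sigma^\sharp,\varphi_0,[\![\cdot]\!]^\sharp,\sqsubseteq,\sqcup,\nabla\rangle$ consists of a join-semilattice $\Sigma^\sharp$ with bottom, an initial state $\varphi_0$, monotone transfer functions $[\![s]\!]^\sharp$, and a widening $\nabla$ with $\varphi\sqcup\varphi'\sqsubseteq\varphi\nabla\varphi'$ such that, for every increasing sequence $(\varphi_i)$, the sequence $y_0=\varphi_0$, $y_{i+1}=y_i\nabla\varphi_{i+1}$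 is eventually constant. The *batch analysis* starts from $\varphi_0$ at the entry; the incoming state of any other location is the join, over its incoming forward edges, of the transferred states of their sources. This is the state at the location unless the location is a loop head. At a loop head with incoming state $x_0$ and back edge labelled $s$ it computes $x_{i+1}=x_i\nabla[\![s]\!]^\sharp(y_i)$, where $y_i$ is the state at the source of the back edge obtained by analysing the loop body (with inner loops iterated to stability) from the head state $x_i$; the state at the head is $x_i$ for the first $i$ with $x_i=x_{i+1}$. The resulting state at $\ell$, with all loop heads at their stable states, is the global invariant $[\![\ell]\!]^{\sharp\ast}$. *DAIGs.* A DAIG $\mathcal D=\langle R,C\rangle$ is a set $R$ of named cells $n[v:\tau]$ or $n[\varepsilon:\tau]$ (holding a statement or an abstract state, or empty) and a set $C$ of computations $n\gets f(n_1,\dots,n_k)$ with $f\in\{[\![\cdot]\!]^\sharp,\sqcup,\nabla,\mathsf{fix}\}$. Names are built from locations, integers, function symbols and values by products $n\cdot n'$ and by iteration counts $n^{(i)}$. $\mathcal D$ is *well-formed* if cell contents have the declared types, cell names and computation destinations are unique, dependencies are acyclic, computations are well-typed, and every empty cell is the destination of a computation. For a location $\ell$, write $\ell^{o}$ for $\underline\ell$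 with a list $o$ of iteration counts, one for each loop containing $\ell$ as a non-head (outermost first), and $n_\ell=\ell^{o,(0)}$ if $\ell$ is a loop head and $n_\ell=\ell^{o}$ otherwise. Below, the source $\ell'$ of a forward edge $\ell'\to\ell$ is represented by $\underline{\ell'}$ with the counts $o$ of $\ell$, which is the fixed-point cell of $\ell'$ if the edge leaves the loop of $\ell'$. $\mathcal D$ is *consistent with the program* if it is well-formed and, for some numbers $u\ge1$ of unrollings, one for each loop and each choice of iterations of the surrounding loops, it contains for all iterations that are present: for each edge $\ell'\xrightarrow{s}\ell$ the statement cell $\underline{\ell'}\cdot\underline\ell\,[s]$ (for the $i$th forward edge into a join location, $\underline i\cdot\underline{\ell'}\cdot\underline\ell\,[s]$); for a forward edge to a non-join location, $n_\ell\gets[\![\cdot]\!]^\sharp(\underline{\ell'}\cdot\underline\ell,\ell'^{\,o})$; for the $i$th forward edge to a join location, $\underline i\cdot n_\ell\gets[\![\cdot]\!]^\sharp(\underline i\cdot\underline{\ell'}\cdot\underline\ell,\ell'^{\,o})$, and $n_\ell\gets\sqcup(\underline1\cdot n_\ell,\dots,\underline m\cdot n_\ell)$; for a back edge $\ell'\to\ell$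 and $0\le i<u$, $\ell^{o,(i)}\cdot\ell^{o,(i+1)}\gets[\![\cdot]\!]^\sharp(\underline{\ell'}\cdot\underline\ell,\ell'^{\,o,(i)})$ and $\ell^{o,(i+1)}\gets\nabla(\ell^{o,(i)},\ell^{o,(i)}\cdot\ell^{o,(i+1)})$; and $\ell^{o}\gets\mathsf{fix}(\ell^{o,(u-1)},\ell^{o,(u)})$. Conversely, every computation of $\mathcal D$ has one of these forms (for arbitrary iterations), and every cell is one of these statement cells, the cell $n_{\ell_0}$, or a state cell that is the destination of a computation of $\mathcal D$. $\mathcal D$ is *consistent with the abstract interpreter* if $n_{\ell_0}[\varphi_0]\in R$ and, whenever a state cell $n[v]\in R$ is non-empty and $n\gets f(n_1,\dots,n_k)\in C$, the cells $n_1,\dots,n_k$ hold values $v_1,\dots,v_k$ with $v=f(v_1,\dots,v_k)$ (with $v=v_1=v_2$ if $f=\mathsf{fix}$). A memo table $M$, a partial map from names to abstract states, is *sound* if each entry $M(\underline f\cdot\underline{v_1}\cdots\underline{v_k})$ is the correct result of $f$ on $v_1,\dots,v_k$ in the same sense. *Queries.* $\mathcal D;M\vdash n\Rightarrow v;\mathcal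 D';M'$ is the least relation given by the following rules. A non-empty cell returns its value. For an empty cell with $n\gets f(n_1,\dots,n_k)\in C$, the cells $n_1,\dots,n_k$ are queried in order, threading the DAIG and the memo table; if the memo table then has an entry for $f(v_1,\dots,v_k)$, this entry is returned and stored in $n$; if it has none and $f\ne\mathsf{fix}$, the value $f(v_1,\dots,v_k)$ is computed, returned, and stored in $n$ and in the memo table. If $f=\mathsf{fix}$ and both sources yield the same value, it is returned and stored in $n$. If $n\gets\mathsf{fix}(n^{(k)},n^{(k+1)})\in C$ and the two sources yield different values, the loop is unrolled once and $n$ is queried again; unrolling duplicates the part of the DAIG after $n^{(k)}$ up to and including $n^{(k+1)}$, with empty cells and with the iteration count of this loop incremented, and replaces the $\mathsf{fix}$ edge by $n\gets\mathsf{fix}(n^{(k+1)},n^{(k+2)})$. **Claim.** Let $\langle L,E,\ell_0\rangle$ be a well-formed program, let an abstract interpreter be given, let $M$ be a sound memo table, and let $\mathcal D$ be a well-formed DAIG that is consistent with the program and with the abstract interpreter. If $\mathcal D;M\vdash\underline\ell\Rightarrow v;\mathcal D';M'$ for a location $\ell$, then the batch analysis yields an invariant at $\ell$, this invariant is unique,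 and $v=[\![\ell]\!]^{\sharp\ast}$. -/

import Mathlib

/-!
# Demanded abstract interpretation graphs (DAIGs)

Control-flow graphs, generic abstract interpreters, the batch abstract interpretation, DAIGs with
their well-formedness and consistency conditions, and the demand-driven query semantics.
-/

namespace Demanded

/-! ## Programs -/

/-- A control-flow edge `src --stmt--> dst`. -/
structure Edge (Loc Stmt : Type*) where
  src : Loc
  stmt : Stmt
  dst : Loc

/-- A program `⟨L, E, ℓ₀⟩`: a finite statement-labelled control-flow graph with an entry. -/
structure Program (Loc Stmt : Type*) where
  L : Finset Loc
  E : Finset (Edge Loc Stmt)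
  entry : Loc

namespace Program

variable {Loc Stmt : Type*} (P : Program Loc Stmt)

/-- One control-flow step, along any edge. -/
def Step (a b : Loc) : Prop := ∃ e ∈ P.E, e.src = a ∧ e.dst = b

/-- There is a path from `a` to `b` that does not pass through `d` (endpoints included). -/
def ReachAvoiding (d a b : Loc) : Prop :=
  a ≠ d ∧ Relation.ReflTransGen (fun x y => P.Step x y ∧ y ≠ d) a b

/-- `d` dominates `ℓ`: every path from the entry to `ℓ` passes through `d`. -/
def Dominates (d ℓ : Loc) : Prop := ¬ P.ReachAvoiding d P.entry ℓ

/-- Back edges: edges whose destination dominates their source. -/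
def BackEdge (e : Edge Loc Stmt) : Prop := e ∈ P.E ∧ P.Dominates e.dst e.src

/-- Forward edges: all the other edges. -/
def FwdEdge (e : Edge Loc Stmt) : Prop := e ∈ P.E ∧ ¬ P.Dominates e.dst e.src

def FwdStep (a b : Loc) : Prop := ∃ e, P.FwdEdge e ∧ e.src = a ∧ e.dst = b

/-- Loop heads: the destinations of back edges. -/
def IsHead (h : Loc) : Prop := ∃ e, P.BackEdge e ∧ e.dst = h

/-- The natural loop with head `h`: the head, and all locations from which the source of the back
edge into `h` can be reached without passing through `h`.  It is empty if `h` is not a head. -/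
def loop (h : Loc) : Set Loc :=
  {ℓ | ℓ ∈ P.L ∧ ∃ e, P.BackEdge e ∧ e.dst = h ∧ (ℓ = h ∨ P.ReachAvoiding h ℓ e.src)}

/-- `ℓ` lies in the loop of `h` and is not its head. -/
def Encloses (h ℓ : Loc) : Prop := ℓ ∈ P.loop h ∧ ℓ ≠ h

/-- The loop of `h` is the innermost loop that contains `ℓ` as a non-head. -/
def Innermost (h ℓ : Loc) : Prop := P.Encloses h ℓ ∧ ∀ g, P.Encloses g ℓ → h ∈ P.loop g

/-- Well-formed programs: reducible control-flow graphs over `L` with at most one back edge into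
each location, in which a natural loop is left only from its head. -/
structure WellFormed : Prop where
  entry_mem : P.entry ∈ P.L
  edges_mem : ∀ e ∈ P.E, e.src ∈ P.L ∧ e.dst ∈ P.L
  fwd_acyclic : ∀ ℓ, ¬ Relation.TransGen P.FwdStep ℓ ℓ
  fwd_spanning : ∀ ℓ ∈ P.L, Relation.ReflTransGen P.FwdStep P.entry ℓ
  back_unique : ∀ e e', P.BackEdge e → P.BackEdge e' → e.dst = e'.dst → e = e'
  exit_head : ∀ e ∈ P.E, ∀ h, e.src ∈ P.loop h → e.dst ∉ P.loop h → e.src = h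

open Classical in
/-- The forward edges into `ℓ`. -/
noncomputable def fwdInto (ℓ : Loc) : Finset (Edge Loc Stmt) :=
  P.E.filter (fun e => P.FwdEdge e ∧ e.dst = ℓ)

/-- A fixed enumeration of the forward edges into `ℓ`; position `i` has index `i + 1`. -/
noncomputable def fwdEdgesTo (ℓ : Loc) : List (Edge Loc Stmt) := (P.fwdInto ℓ).toList

/-- Join locations: at least two incoming forward edges. -/
def IsJoin (ℓ : Loc) : Prop := 2 ≤ (P.fwdEdgesTo ℓ).length

end Program

/-! ## Abstract interpreters and the batch analysis -/

/-- A generic abstract interpreter over the join-semilattice with bottom `A`. -/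
structure AbstractInterpreter (Stmt A : Type*) [SemilatticeSup A] [OrderBot A] where
  init : A
  transfer : Stmt → A → A
  widen : A → A → A
  transfer_mono : ∀ s, Monotone (transfer s)
  sup_le_widen : ∀ φ ψ, φ ⊔ ψ ≤ widen φ ψ
  widen_converges : ∀ φ : ℕ → A, Monotone φ → ∀ y : ℕ → A, y 0 = φ 0 →
    (∀ n, y (n + 1) = widen (y n) (φ (n + 1))) → ∃ N, ∀ n, N ≤ n → y n = y N

/-- The quantities that the batch analysis computes.  `held` is `none` for an analysis of the whole
program, and `some (h, x)` for one pass over the body of the loop of `h` with the state at the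
head `h` held at `x`. -/
inductive Goal (Loc A : Type*) where
  /-- the abstract state at `ℓ` -/
  | at (held : Option (Loc × A)) (ℓ : Loc)
  /-- the abstract state that flows into `ℓ` along its forward edges -/
  | entry (held : Option (Loc × A)) (ℓ : Loc)
  /-- the `i`th abstract iterate at the loop head `h` when the loop is entered with `y₀` -/
  | iterate (h : Loc) (y₀ : A) (i : ℕ)

/-- The batch abstract interpretation: forward propagation with joins and, at each loop head,
iteration with widening of the whole loop body until two consecutive iterates are equal (loops that
are nested in the body are iterated to stability in each pass over the body).
`Batch P I g φ` says that the computation of the quantity `g` terminates with result `φ`. -/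
inductive Batch {Loc Stmt A : Type*} [SemilatticeSup A] [OrderBot A]
    (P : Program Loc Stmt) (I : AbstractInterpreter Stmt A) : Goal Loc A → A → Prop where
  | held {h : Loc} {x : A} : Batch P I (.at (some (h, x)) h) x
  | plain {held : Option (Loc × A)} {ℓ : Loc} {φ : A} :
      (∀ x, held ≠ some (ℓ, x)) → ¬ P.IsHead ℓ →
      Batch P I (.entry held ℓ) φ → Batch P I (.at held ℓ) φ
  | stable {held : Option (Loc × A)} {ℓ : Loc} {y₀ φ : A} {i : ℕ} :
      (∀ x, held ≠ some (ℓ, x)) → P.IsHead ℓ →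
      Batch P I (.entry held ℓ) y₀ →
      Batch P I (.iterate ℓ y₀ i) φ → Batch P I (.iterate ℓ y₀ (i + 1)) φ →
      Batch P I (.at held ℓ) φ
  | start {held : Option (Loc × A)} : Batch P I (.entry held P.entry) I.init
  | flow {held : Option (Loc × A)} {ℓ : Loc} {w : Edge Loc Stmt → A} :
      ℓ ∈ P.L → ℓ ≠ P.entry →
      (∀ e ∈ P.fwdInto ℓ, Batch P I (.at held e.src) (w e)) →
      Batch P I (.entry held ℓ) ((P.fwdInto ℓ).sup fun e => I.transfer e.stmt (w e))
  | first {h : Loc} {y₀ : A} : Batch P I (.iterate h y₀ 0) y₀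
  | next {h : Loc} {y₀ y φ : A} {i : ℕ} {e : Edge Loc Stmt} :
      P.BackEdge e → e.dst = h →
      Batch P I (.iterate h y₀ i) y → Batch P I (.at (some (h, y)) e.src) φ →
      Batch P I (.iterate h y₀ (i + 1)) (I.widen y (I.transfer e.stmt φ))

/-- `φ` is the invariant at `ℓ` in the global invariant map of the batch analysis. -/
def GlobalInvariant {Loc Stmt A : Type*} [SemilatticeSup A] [OrderBot A]
    (P : Program Loc Stmt) (I : AbstractInterpreter Stmt A) (ℓ : Loc) (φ : A) : Prop :=
  Batch P I (.at none ℓ) φ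

/-! ## Syntax of DAIGs -/

/-- Function symbols. -/
inductive Fn where
  | transfer | join | widen | fix

/-- Types of reference cells. -/
inductive Ty where
  | stmt | state

/-- Values of reference cells. -/
inductive Val (Stmt A : Type*) where
  | stmt (s : Stmt)
  | state (φ : A)

def Val.ty {Stmt A : Type*} : Val Stmt A → Ty
  | .stmt _ => .stmt
  | .state _ => .state

/-- Names; `iter n i` is the `i`th unrolled copy of `n`. -/
inductive Nm (Loc Stmt A : Type*) where
  | loc (ℓ : Loc)
  | fn (f : Fn)
  | int (i : ℕ)
  | val (v : Val Stmt A)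
  | prod (n₁ n₂ : Nm Loc Stmt A)
  | iter (n : Nm Loc Stmt A) (i : ℕ)

namespace Nm

variable {Loc Stmt A : Type*}

/-- The number of iteration counts that a name carries. -/
def primes : Nm Loc Stmt A → ℕ
  | iter n _ => n.primes + 1
  | _ => 0

/-- Increment the iteration count at position `d` (the outermost loop has position `0`), in both
factors of a product; names without such a count are unchanged. -/
def incr (d : ℕ) : Nm Loc Stmt A → Nm Loc Stmt A
  | iter n i => if n.primes = d then iter n (i + 1) else iter (incr d n) i
  | prod a b => prod (incr d a) (incr d b)
  | n => n

/-- The name of `ℓ` with iteration counts `o`, one for each loop, the outermost loop first. -/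
def cell (ℓ : Loc) (o : List ℕ) : Nm Loc Stmt A := o.foldl iter (loc ℓ)

/-- The name `f · v₁ ⋯ vₖ` under which the memo table stores the result `f(v₁, …, vₖ)`. -/
def memo (f : Fn) (vs : List (Val Stmt A)) : Nm Loc Stmt A :=
  vs.foldl (fun n v => prod n (val v)) (fn f)

end Nm

/-- A named, typed reference cell, holding a value or (`none`) empty. -/
structure Ref (Loc Stmt A : Type*) where
  name : Nm Loc Stmt A
  ty : Ty
  val : Option (Val Stmt A)

/-- A computation `dest ← fn(srcs)`. -/
structure Comp (Loc Stmt A : Type*) where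
  dest : Nm Loc Stmt A
  fn : Fn
  srcs : List (Nm Loc Stmt A)

def Comp.incr {Loc Stmt A : Type*} (d : ℕ) (c : Comp Loc Stmt A) : Comp Loc Stmt A :=
  ⟨c.dest.incr d, c.fn, c.srcs.map (Nm.incr d)⟩

structure DAIG (Loc Stmt A : Type*) where
  R : Set (Ref Loc Stmt A)
  C : Set (Comp Loc Stmt A)

namespace DAIG

variable {Loc Stmt A : Type*} (D : DAIG Loc Stmt A)

/-- Reachability by one or more computations. -/
def Reach : Nm Loc Stmt A → Nm Loc Stmt A → Prop :=
  Relation.TransGen fun n n' => ∃ c ∈ D.C, n ∈ c.srcs ∧ c.dest = n'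

open Classical in
/-- `D[n ↦ v]` -/
noncomputable def write (n : Nm Loc Stmt A) (v : Val Stmt A) : DAIG Loc Stmt A where
  R := (fun r => if r.name = n then { r with val := some v } else r) '' D.R
  C := D.C

/-- `n` names a reference cell of type `τ`. -/
def HasTy (n : Nm Loc Stmt A) (τ : Ty) : Prop := ∃ r ∈ D.R, r.name = n ∧ r.ty = τ

/-- The typing judgment for computations. -/
def Typed (c : Comp Loc Stmt A) : Prop :=
  D.HasTy c.dest .state ∧
    match c.fn with
    | .transfer => ∃ n₁ n₂, c.srcs = [n₁, n₂] ∧ D.HasTy n₁ .stmt ∧ D.HasTy n₂ .state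
    | .join => c.srcs ≠ [] ∧ ∀ n ∈ c.srcs, D.HasTy n .state
    | .widen => c.srcs ≠ [] ∧ ∀ n ∈ c.srcs, D.HasTy n .state
    | .fix => ∃ n₁ n₂, c.srcs = [n₁, n₂] ∧ D.HasTy n₁ .state ∧ D.HasTy n₂ .state

structure WellFormed : Prop where
  vals_typed : ∀ r ∈ D.R, ∀ v, r.val = some v → v.ty = r.ty
  names_unique : ∀ r ∈ D.R, ∀ r' ∈ D.R, r.name = r'.name → r = r'
  dests_unique : ∀ c ∈ D.C, ∀ c' ∈ D.C, c.dest = c'.dest → c = c'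
  acyclic : ∀ r ∈ D.R, ¬ D.Reach r.name r.name
  comps_typed : ∀ c ∈ D.C, D.Typed c
  empty_dest : ∀ r ∈ D.R, r.val = none → ∃ c ∈ D.C, c.dest = r.name

/-- Unroll by one iteration the loop of the computation `n ← fix(n⁽ᵏ⁾, n⁽ᵏ⁺¹⁾)`: duplicate the
region after `n⁽ᵏ⁾` up to and including `n⁽ᵏ⁺¹⁾` with the iteration count of this loop
incremented, and let the `fix` edge depend on `n⁽ᵏ⁺¹⁾` and `n⁽ᵏ⁺²⁾`. -/
def unroll (n : Nm Loc Stmt A) (k : ℕ) : DAIG Loc Stmt A where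
  R := D.R ∪ {r | ∃ m, D.Reach (n.iter k) m ∧ (m = n.iter (k + 1) ∨ D.Reach m (n.iter (k + 1))) ∧
    r = ⟨m.incr n.primes, .state, none⟩}
  C := (D.C \ {⟨n, .fix, [n.iter k, n.iter (k + 1)]⟩}) ∪
    {⟨n, .fix, [n.iter (k + 1), n.iter (k + 2)]⟩} ∪
    {c | ∃ c' ∈ D.C, D.Reach (n.iter k) c'.dest ∧
      (c'.dest = n.iter (k + 1) ∨ D.Reach c'.dest (n.iter (k + 1))) ∧ c = c'.incr n.primes}

end DAIG

/-! ## DAIG--CFG consistency -/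

namespace Program

variable {Loc Stmt : Type*} (P : Program Loc Stmt)

/-- `P.Ctx b ℓ o`: the list `o` consists of one iteration number for each loop that contains `ℓ` as
a non-head, outermost first, where `b h o i` says that the iteration `i` of the loop of `h` is
present within the surrounding iterations `o`. -/
inductive Ctx (b : Loc → List ℕ → ℕ → Prop) : Loc → List ℕ → Prop where
  | top {ℓ : Loc} : (∀ h, ¬ P.Encloses h ℓ) → Ctx b ℓ []
  | inner {h ℓ : Loc} {o : List ℕ} {i : ℕ} :
      P.Innermost h ℓ → Ctx b h o → b h o i → Ctx b ℓ (o ++ [i])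

open Classical in
/-- The name of the abstract state at `ℓ` as the destination of forward flow, within the iterations
`o` of the surrounding loops: the `0`th iterate if `ℓ` is a loop head. -/
noncomputable def entryName {A : Type*} (ℓ : Loc) (o : List ℕ) : Nm Loc Stmt A :=
  if P.IsHead ℓ then .iter (.cell ℓ o) 0 else .cell ℓ o

/-- The statement cells, which encode the labels of the control-flow edges. -/
inductive StmtCell {A : Type*} : Ref Loc Stmt A → Prop where
  | fwd {e : Edge Loc Stmt} : P.FwdEdge e → ¬ P.IsJoin e.dst →
      StmtCell ⟨.prod (.loc e.src) (.loc e.dst), .stmt, some (.stmt e.stmt)⟩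
  | join {ℓ : Loc} {i : ℕ} {e : Edge Loc Stmt} : P.IsJoin ℓ → (P.fwdEdgesTo ℓ)[i]? = some e →
      StmtCell ⟨.prod (.int (i + 1)) (.prod (.loc e.src) (.loc ℓ)), .stmt, some (.stmt e.stmt)⟩
  | back {e : Edge Loc Stmt} : P.BackEdge e →
      StmtCell ⟨.prod (.loc e.src) (.loc e.dst), .stmt, some (.stmt e.stmt)⟩

/-- The computations that encode the program, where `b h o i` says that the iteration `i` of the
loop of `h` (within the surrounding iterations `o`) is present, and `f h o k` that its `fix` edge
may depend on the iterates `k` and `k + 1`.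

In a program whose loops are left only from their heads, the state at the source `ℓ'` of an edge
into `ℓ` is always the cell of `ℓ'` with the iteration counts of the loops that surround `ℓ`: it is
the fixed-point cell of `ℓ'` if the edge leaves the loop of `ℓ'`, and otherwise the cell of `ℓ'` in
the current iteration. -/
inductive Encodes {A : Type*} (b f : Loc → List ℕ → ℕ → Prop) : Comp Loc Stmt A → Prop where
  /-- forward edges to non-join locations -/
  | transfer {e : Edge Loc Stmt} {o : List ℕ} :
      P.FwdEdge e → ¬ P.IsJoin e.dst → P.Ctx b e.dst o →
      Encodes b f ⟨P.entryName e.dst o, .transfer,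
        [.prod (.loc e.src) (.loc e.dst), .cell e.src o]⟩
  /-- forward edges to join locations: one pre-join state for each edge -/
  | preJoin {ℓ : Loc} {i : ℕ} {e : Edge Loc Stmt} {o : List ℕ} :
      P.IsJoin ℓ → (P.fwdEdgesTo ℓ)[i]? = some e → P.Ctx b ℓ o →
      Encodes b f ⟨.prod (.int (i + 1)) (P.entryName ℓ o), .transfer,
        [.prod (.int (i + 1)) (.prod (.loc e.src) (.loc ℓ)), .cell e.src o]⟩
  /-- the join of all the pre-join states -/
  | join {ℓ : Loc} {o : List ℕ} :
      P.IsJoin ℓ → P.Ctx b ℓ o →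
      Encodes b f ⟨P.entryName ℓ o, .join,
        (List.range (P.fwdEdgesTo ℓ).length).map fun i => .prod (.int (i + 1)) (P.entryName ℓ o)⟩
  /-- back edges: the pre-widen state at the end of iteration `i` -/
  | back {e : Edge Loc Stmt} {o : List ℕ} {i : ℕ} :
      P.BackEdge e → P.Ctx b e.dst o → b e.dst o i →
      Encodes b f ⟨.prod (.iter (.cell e.dst o) i) (.iter (.cell e.dst o) (i + 1)), .transfer,
        [.prod (.loc e.src) (.loc e.dst), .cell e.src (o ++ [i])]⟩
  /-- the widening that yields iterate `i + 1` -/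
  | widen {h : Loc} {o : List ℕ} {i : ℕ} :
      P.IsHead h → P.Ctx b h o → b h o i →
      Encodes b f ⟨.iter (.cell h o) (i + 1), .widen,
        [.iter (.cell h o) i, .prod (.iter (.cell h o) i) (.iter (.cell h o) (i + 1))]⟩
  /-- the fixed point of the loop -/
  | fix {h : Loc} {o : List ℕ} {k : ℕ} :
      P.IsHead h → P.Ctx b h o → f h o k →
      Encodes b f ⟨.cell h o, .fix, [.iter (.cell h o) k, .iter (.cell h o) (k + 1)]⟩

end Program

namespace DAIG

variable {Loc Stmt A : Type*} (D : DAIG Loc Stmt A)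

/-- DAIG--CFG consistency.  For some numbers `u h o ≥ 1` of unrollings (one for each loop and each
choice `o` of iterations of the surrounding loops), `D` contains the encoding of the program;
and `D` contains nothing but cells and computations that encode the program (it may contain
further unrolled iterations, which remain behind when edits reset a `fix` edge). -/
structure CfgConsistent (P : Program Loc Stmt) : Prop where
  wf : D.WellFormed
  stmts : ∀ r, P.StmtCell r → r ∈ D.R
  encodes : ∃ u : Loc → List ℕ → ℕ, (∀ h o, 1 ≤ u h o) ∧
    ∀ c, P.Encodes (fun h o i => i < u h o) (fun h o k => k + 1 = u h o) c → c ∈ D.C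
  only_comps : ∀ c ∈ D.C, P.Encodes (fun _ _ _ => True) (fun _ _ _ => True) c
  only_cells : ∀ r ∈ D.R, P.StmtCell r ∨
    (r.ty = .state ∧ (r.name = P.entryName P.entry [] ∨ ∃ c ∈ D.C, c.dest = r.name))

end DAIG

/-! ## DAIG--AI consistency, memo tables, queries -/

/-- Left-associated `k`-ary version of a binary operation on abstract states. -/
def foldStates {Stmt A : Type*} (op : A → A → A) : List (Val Stmt A) → Option A
  | [] => none
  | v :: vs => vs.foldl
      (fun acc w => match acc, w with
        | some φ, .state ψ => some (op φ ψ)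
        | _, _ => none)
      (match v with
        | .state φ => some φ
        | .stmt _ => none)

namespace AbstractInterpreter

variable {Stmt A : Type*} [SemilatticeSup A] [OrderBot A] (I : AbstractInterpreter Stmt A)

/-- The result `f(v₁, …, vₖ)`; `none` on arguments of the wrong number or type, and for `fix`. -/
def apply : Fn → List (Val Stmt A) → Option A
  | .transfer, [.stmt s, .state φ] => some (I.transfer s φ)
  | .join, vs => foldStates (· ⊔ ·) vs
  | .widen, vs => foldStates I.widen vs
  | _, _ => none

/-- `v` is a correct result for `f` on `v₁, …, vₖ`: for `fix` this means `v = v₁ = v₂`, and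
`v = f(v₁, …, vₖ)` otherwise. -/
def Yields (f : Fn) (vs : List (Val Stmt A)) (v : Val Stmt A) : Prop :=
  match f with
  | .fix => vs = [v, v]
  | f => ∃ φ, I.apply f vs = some φ ∧ v = .state φ

end AbstractInterpreter

/-- DAIG--AI consistency: the cell for the entry state of the program holds the initial abstract
state, and each stored analysis result agrees with the computation that leads to it. -/
structure DAIG.AIConsistent {Loc Stmt A : Type*} [SemilatticeSup A] [OrderBot A]
    (D : DAIG Loc Stmt A) (P : Program Loc Stmt) (I : AbstractInterpreter Stmt A) : Prop where
  init_mem : ⟨P.entryName P.entry [], .state, some (.state I.init)⟩ ∈ D.R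
  results : ∀ n v, ⟨n, .state, some v⟩ ∈ D.R → ∀ f ns, ⟨n, f, ns⟩ ∈ D.C →
    ∃ vs, List.Forall₂ (fun m w => ∃ τ, ⟨m, τ, some w⟩ ∈ D.R) ns vs ∧ I.Yields f vs v

/-- Memo tables: partial maps from names to abstract states. -/
abbrev Memo (Loc Stmt A : Type*) := Nm Loc Stmt A → Option A

/-- A memo table is sound if all the results that it stores are correct. -/
def Memo.Sound {Loc Stmt A : Type*} [SemilatticeSup A] [OrderBot A]
    (M : Memo Loc Stmt A) (I : AbstractInterpreter Stmt A) : Prop :=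
  ∀ f vs φ, M (.memo f vs) = some φ → I.Yields f vs (.state φ)

open Classical in
/-- The query judgment: requesting `n` from `D` with memo table `M` yields the value `v`, the
updated DAIG `D'` and the updated memo table `M'`. -/
inductive Query {Loc Stmt A : Type*} [SemilatticeSup A] [OrderBot A]
    (I : AbstractInterpreter Stmt A) :
    DAIG Loc Stmt A → Memo Loc Stmt A → Nm Loc Stmt A → Val Stmt A →
      DAIG Loc Stmt A → Memo Loc Stmt A → Prop where
  | reuse {D : DAIG Loc Stmt A} {M : Memo Loc Stmt A} {n : Nm Loc Stmt A} {τ : Ty}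
      {v : Val Stmt A} :
      ⟨n, τ, some v⟩ ∈ D.R →
      Query I D M n v D M
  | found {D : ℕ → DAIG Loc Stmt A} {M : ℕ → Memo Loc Stmt A} {n : Nm Loc Stmt A} {τ : Ty}
      {f : Fn} {ns : List (Nm Loc Stmt A)} {vs : Fin ns.length → Val Stmt A} {φ : A} :
      ⟨n, τ, none⟩ ∈ (D 0).R → ⟨n, f, ns⟩ ∈ (D 0).C →
      (∀ i : Fin ns.length, Query I (D i) (M i) ns[i] (vs i) (D (i + 1)) (M (i + 1))) →
      M ns.length (.memo f (List.ofFn vs)) = some φ →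
      Query I (D 0) (M 0) n (.state φ) ((D ns.length).write n (.state φ)) (M ns.length)
  | miss {D : ℕ → DAIG Loc Stmt A} {M : ℕ → Memo Loc Stmt A} {n : Nm Loc Stmt A} {τ : Ty}
      {f : Fn} {ns : List (Nm Loc Stmt A)} {vs : Fin ns.length → Val Stmt A} {φ : A} :
      ⟨n, τ, none⟩ ∈ (D 0).R → ⟨n, f, ns⟩ ∈ (D 0).C →
      (∀ i : Fin ns.length, Query I (D i) (M i) ns[i] (vs i) (D (i + 1)) (M (i + 1))) →
      M ns.length (.memo f (List.ofFn vs)) = none →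
      f ≠ .fix → I.apply f (List.ofFn vs) = some φ →
      Query I (D 0) (M 0) n (.state φ) ((D ns.length).write n (.state φ))
        (Function.update (M ns.length) (.memo f (List.ofFn vs)) (some φ))
  | converge {D D' D'' : DAIG Loc Stmt A} {M M' M'' : Memo Loc Stmt A}
      {n n₁ n₂ : Nm Loc Stmt A} {τ : Ty} {v : Val Stmt A} :
      ⟨n, τ, none⟩ ∈ D.R → ⟨n, .fix, [n₁, n₂]⟩ ∈ D.C →
      Query I D M n₁ v D' M' → Query I D' M' n₂ v D'' M'' →
      Query I D M n v (D''.write n v) M''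
  | unroll {D D' D'' D''' : DAIG Loc Stmt A} {M M' M'' M''' : Memo Loc Stmt A}
      {n : Nm Loc Stmt A} {k : ℕ} {τ : Ty} {v v' v'' : Val Stmt A} :
      ⟨n, τ, none⟩ ∈ D.R → ⟨n, .fix, [n.iter k, n.iter (k + 1)]⟩ ∈ D.C →
      Query I D M (n.iter k) v' D' M' → Query I D' M' (n.iter (k + 1)) v'' D'' M'' →
      v' ≠ v'' →
      Query I (D''.unroll n k) M'' n v D''' M''' →
      Query I D M n v D''' M'''

end Demanded

/-!
The proof compares the values in the cells of a DAIG with the results of the batch analysis, one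
name at a time.  `Held P I ℓ o hd` translates a list `o` of iteration counts into the form of
context that the batch analysis uses: the innermost loop around `ℓ` with its head held at the
iterate that the last count selects.  `Denotes P I n v` then says which value `v` the batch
analysis gives to the name `n`.  It is not recursive, and it is functional because the batch
analysis is deterministic (`Batch.unique`).

The central fact is `Denotes.of_encoded`: if the sources of a computation that encodes the program
hold the values that the batch analysis gives to them, so does its destination.  It rests on the
shape of well-formed programs: a forward edge stays on one nesting level or enters a loop body from
the head (`FwdEdge.enclosing`), and a back edge starts at the head or directly inside its loop
(`BackEdge.innermost`).  Hence the cell that represents the source of an edge holds the state that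
the batch analysis reads there.

Two further arguments are needed.  The values that a consistent DAIG holds initially are the right
ones by induction along its computations.  Since the DAIG may be infinite, this uses that the
dependencies among all encoding computations are well-founded (`dependsOn_wf`), which follows by an
induction that treats inner loops first and each nesting level in topological order.  And
unrolling must add only computations that again encode the program (`unroll_encoded`): since the
dependencies are acyclic, everything between the iterates `k` and `k + 1` of a loop head belongs to
iteration `k` (`Encoded.inRegion`), and incrementing the count of the loop turns it into the
corresponding part of iteration `k + 1` (`Encoded.incr`).

With these, an induction on the query derivation (`Query.sound`) shows that a query returns the
value that the name denotes, which for `ℓ` without iteration counts is the global invariant.  The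
convergence of widening is not needed, as the query is assumed to have terminated: the iteration at
which a `fix` computation finds two equal values is a stable iteration of the batch analysis.
-/

namespace Demanded

/-! ### Dominance, natural loops and nesting -/

namespace Program

variable {Loc Stmt : Type*} {P : Program Loc Stmt}

theorem ReachAvoiding.right_ne {d a b : Loc} (h : P.ReachAvoiding d a b) : b ≠ d := by
  obtain ⟨ha, hp⟩ := h
  rcases Relation.ReflTransGen.cases_tail hp with rfl | ⟨c, -, -, hb⟩
  exacts [ha, hb]

theorem ReachAvoiding.trans {d a b c : Loc} (h : P.ReachAvoiding d a b)
    (h' : P.ReachAvoiding d b c) : P.ReachAvoiding d a c :=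
  ⟨h.1, h.2.trans h'.2⟩

theorem ReachAvoiding.head {d a b c : Loc} (ha : a ≠ d) (hab : P.Step a b)
    (h : P.ReachAvoiding d b c) : P.ReachAvoiding d a c :=
  ⟨ha, h.2.head ⟨hab, h.1⟩⟩

theorem dominates_entry (ℓ : Loc) : P.Dominates P.entry ℓ := fun h => h.1 rfl

theorem FwdEdge.dst_ne_entry {e : Edge Loc Stmt} (he : P.FwdEdge e) : e.dst ≠ P.entry := by
  intro h
  exact he.2 (h ▸ dominates_entry _)

theorem FwdStep.step {a b : Loc} (h : P.FwdStep a b) : P.Step a b := by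
  obtain ⟨e, he, h⟩ := h
  exact ⟨e, he.1, h⟩

theorem BackEdge.isHead {e : Edge Loc Stmt} (he : P.BackEdge e) : P.IsHead e.dst := ⟨e, he, rfl⟩

theorem dominates_of_mem_loop {h ℓ : Loc} (hl : ℓ ∈ P.loop h) : P.Dominates h ℓ := by
  obtain ⟨-, e, he, rfl, rfl | hr⟩ := hl
  · exact fun hc => hc.right_ne rfl
  · exact fun hc => he.2 (hc.trans hr)

theorem Encloses.isHead {h ℓ : Loc} (hl : P.Encloses h ℓ) : P.IsHead h := by
  obtain ⟨⟨-, e, he, rfl, -⟩, -⟩ := hl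
  exact he.isHead

theorem not_encloses_entry (h : Loc) : ¬ P.Encloses h P.entry := fun hc =>
  dominates_of_mem_loop hc.1 ⟨hc.2, .refl⟩

theorem IsHead.mem_loop (hP : P.WellFormed) {h : Loc} (hh : P.IsHead h) : h ∈ P.loop h := by
  obtain ⟨e, he, rfl⟩ := hh
  exact ⟨(hP.edges_mem e he.1).2, e, he, rfl, .inl rfl⟩

theorem mem_loop_of_step (hP : P.WellFormed) {e : Edge Loc Stmt} (he : e ∈ P.E) {h : Loc}
    (hd : P.Encloses h e.dst) (hs : e.src ≠ h) : e.src ∈ P.loop h := by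
  obtain ⟨⟨-, b, hb, rfl, hr⟩, hne⟩ := hd
  exact ⟨(hP.edges_mem e he).1, b, hb, rfl,
    .inr (ReachAvoiding.head hs ⟨e, he, rfl, rfl⟩ (hr.resolve_left hne))⟩

/-- A dominator is an ancestor along forward edges, since some forward path from the entry
leads to the dominated location. -/
theorem Dominates.fwd_path (hP : P.WellFormed) {h ℓ : Loc} (hd : P.Dominates h ℓ)
    (hl : ℓ ∈ P.L) : Relation.ReflTransGen P.FwdStep h ℓ := by
  have key : P.ReachAvoiding h P.entry ℓ ∨ Relation.ReflTransGen P.FwdStep h ℓ := by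
    clear hd
    have hp := hP.fwd_spanning ℓ hl
    clear hl
    induction hp with
    | refl =>
      by_cases he : P.entry = h
      · exact .inr (he ▸ .refl)
      · exact .inl ⟨he, .refl⟩
    | @tail b c _ hbc ih =>
      rcases ih with ih | ih
      · by_cases hc : c = h
        · exact .inr (hc ▸ .refl)
        · exact .inl ⟨ih.1, ih.2.tail ⟨hbc.step, hc⟩⟩
      · exact .inr (ih.tail hbc)
  exact key.resolve_left hd

theorem Dominates.antisymm (hP : P.WellFormed) {g h : Loc} (hg : g ∈ P.L) (hh : h ∈ P.L)
    (h₁ : P.Dominates g h) (h₂ : P.Dominates h g) : g = h := by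
  rcases Relation.reflTransGen_iff_eq_or_transGen.1 (h₁.fwd_path hP hh) with h | h
  · exact h.symm
  · exact (hP.fwd_acyclic g (h.trans_left (h₂.fwd_path hP hg))).elim

theorem Innermost.unique (hP : P.WellFormed) {g h ℓ : Loc} (hg : P.Innermost g ℓ)
    (hh : P.Innermost h ℓ) : g = h :=
  have h₁ := hh.2 g hg.1
  have h₂ := hg.2 h hh.1
  Dominates.antisymm hP h₂.1 h₁.1 (dominates_of_mem_loop h₁) (dominates_of_mem_loop h₂)

theorem FwdEdge.encloses_dst (hP : P.WellFormed) {e : Edge Loc Stmt} (he : P.FwdEdge e) {g : Loc}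
    (hg : P.Encloses g e.src) : P.Encloses g e.dst := by
  refine ⟨?_, ?_⟩
  · by_contra hc
    exact hg.2 (hP.exit_head e he.1 g hg.1 hc)
  · rintro rfl
    exact he.2 (dominates_of_mem_loop hg.1)

theorem FwdEdge.encloses_src (hP : P.WellFormed) {e : Edge Loc Stmt} (he : P.FwdEdge e) {g : Loc}
    (hg : P.Encloses g e.dst) (hne : e.src ≠ g) : P.Encloses g e.src :=
  ⟨mem_loop_of_step hP he.1 hg hne, hne⟩

/-- A forward edge either stays at the same nesting level or leads from a loop head into the body
of its loop. -/
theorem FwdEdge.enclosing (hP : P.WellFormed) {e : Edge Loc Stmt} (he : P.FwdEdge e) :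
    (∀ g, P.Encloses g e.src ↔ P.Encloses g e.dst) ∨ P.Innermost e.src e.dst := by
  by_cases h : P.Encloses e.src e.dst
  · refine .inr ⟨h, fun g hg => ?_⟩
    by_cases hs : e.src = g
    · exact hs ▸ h.isHead.mem_loop hP
    · exact (he.encloses_src hP hg hs).1
  · exact .inl fun g => ⟨he.encloses_dst hP, fun hg => he.encloses_src hP hg
      fun hs => h (hs ▸ hg)⟩

theorem BackEdge.innermost (hP : P.WellFormed) {e : Edge Loc Stmt} (he : P.BackEdge e)
    (hne : e.src ≠ e.dst) : P.Innermost e.dst e.src := by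
  refine ⟨⟨⟨(hP.edges_mem e he.1).1, e, he, rfl, .inr ⟨hne, .refl⟩⟩, hne⟩, fun g hg => ?_⟩
  by_contra hc
  exact hg.2 (hP.exit_head e he.1 g hg.1 hc)

theorem BackEdge.encloses_src (hP : P.WellFormed) {e : Edge Loc Stmt} (he : P.BackEdge e)
    {h : Loc} (hh : P.Encloses h e.dst) : P.Encloses h e.src := by
  have hne : e.src ≠ h := by
    rintro rfl
    exact hh.2 (Dominates.antisymm hP (hP.edges_mem e he.1).2 (hP.edges_mem e he.1).1 he.2
      (dominates_of_mem_loop hh.1))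
  exact ⟨mem_loop_of_step hP he.1 hh hne, hne⟩

theorem innermost_congr {a b : Loc} (hab : ∀ g, P.Encloses g a ↔ P.Encloses g b) {h : Loc} :
    P.Innermost h a ↔ P.Innermost h b := by
  simp only [Innermost, hab]

/-! ### Iteration contexts -/

/-- The lists of iteration counts of the right length for `ℓ`, without a bound on the counts. -/
abbrev AnyCtx (P : Program Loc Stmt) (ℓ : Loc) (o : List ℕ) : Prop :=
  P.Ctx (fun _ _ _ => True) ℓ o

/-- The computations that encode the program, for arbitrary iterations. -/
abbrev Encoded {A : Type*} (P : Program Loc Stmt) (c : Comp Loc Stmt A) : Prop :=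
  P.Encodes (fun _ _ _ => True) (fun _ _ _ => True) c

theorem AnyCtx.length_eq (hP : P.WellFormed) {ℓ : Loc} {o o' : List ℕ} (h : P.AnyCtx ℓ o)
    (h' : P.AnyCtx ℓ o') : o.length = o'.length := by
  induction h generalizing o' with
  | top hn =>
    cases h' with
    | top => rfl
    | inner hi => exact (hn _ hi.1).elim
  | inner hi _ _ ih =>
    cases h' with
    | top hn => exact (hn _ hi.1).elim
    | inner hi' hc' =>
      obtain rfl := hi.unique hP hi'
      simp [ih hc']

theorem AnyCtx.length_lt (hP : P.WellFormed) {h ℓ : Loc} {o p : List ℕ} (hh : P.AnyCtx h o)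
    (hl : P.AnyCtx ℓ p) (he : P.Encloses h ℓ) : o.length < p.length := by
  induction hl with
  | top hn => exact (hn _ he).elim
  | @inner g ℓ q i hi hc _ ih =>
    by_cases hg : g = h
    · subst hg
      simp [hh.length_eq hP hc]
    · have := ih ⟨hi.2 h he, hg⟩
      simp; omega

theorem AnyCtx.of_length_eq {ℓ : Loc} {o o' : List ℕ} (h : P.AnyCtx ℓ o)
    (hl : o'.length = o.length) : P.AnyCtx ℓ o' := by
  induction h generalizing o' with
  | top hn =>
    obtain rfl := List.eq_nil_of_length_eq_zero hl
    exact .top hn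
  | inner hi _ _ ih =>
    rcases List.eq_nil_or_concat o' with rfl | ⟨q, j, rfl⟩
    · simp at hl
    · simp only [List.concat_eq_append] at hl ⊢
      exact .inner hi (ih (by simpa using hl)) trivial

theorem AnyCtx.congr {a b : Loc} (hab : ∀ g, P.Encloses g a ↔ P.Encloses g b) {o : List ℕ}
    (h : P.AnyCtx a o) : P.AnyCtx b o := by
  cases h with
  | top hn => exact .top fun g hg => hn g ((hab g).2 hg)
  | inner hi hc _ => exact .inner ((innermost_congr hab).1 hi) hc trivial

theorem AnyCtx.of_innermost (hP : P.WellFormed) {h ℓ : Loc} {o : List ℕ} (hi : P.Innermost h ℓ)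
    (hc : P.AnyCtx ℓ o) : ∃ o' i, o = o' ++ [i] ∧ P.AnyCtx h o' := by
  cases hc with
  | top hn => exact (hn _ hi.1).elim
  | inner hi' hc _ =>
    obtain rfl := hi.unique hP hi'
    exact ⟨_, _, rfl, hc⟩

theorem AnyCtx.append_false (hP : P.WellFormed) {ℓ : Loc} {o : List ℕ} {i : ℕ}
    (h : P.AnyCtx ℓ o) (h' : P.AnyCtx ℓ (o ++ [i])) : False := by
  simpa using h.length_eq hP h'

end Program

/-! ### Names -/

namespace Nm

variable {Loc Stmt A : Type*}

theorem modify_append_of_lt {f : ℕ → ℕ} {o : List ℕ} {d i : ℕ} (h : d < o.length) :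
    (o ++ [i]).modify d f = o.modify d f ++ [i] := by
  induction o generalizing d with
  | nil => simp at h
  | cons a o ih =>
    cases d with
    | zero => simp
    | succ d => simpa using ih (by simpa using h)

theorem modify_append_length {f : ℕ → ℕ} {o : List ℕ} {i : ℕ} :
    (o ++ [i]).modify o.length f = o ++ [f i] := by
  induction o with
  | nil => simp
  | cons a o ih => simpa using ih

theorem cell_append (ℓ : Loc) (o : List ℕ) (i : ℕ) :
    (cell ℓ (o ++ [i]) : Nm Loc Stmt A) = iter (cell ℓ o) i := by
  simp [cell]

theorem cell_inj {ℓ ℓ' : Loc} {o o' : List ℕ}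
    (h : (cell ℓ o : Nm Loc Stmt A) = cell ℓ' o') : ℓ = ℓ' ∧ o = o' := by
  induction o using List.reverseRecOn generalizing o' with
  | nil =>
    rcases List.eq_nil_or_concat o' with rfl | ⟨q, j, rfl⟩
    · simpa [cell] using h
    · simp [cell] at h
  | append_singleton o i ih =>
    rcases List.eq_nil_or_concat o' with rfl | ⟨q, j, rfl⟩
    · simp [cell] at h
    · simp only [List.concat_eq_append, cell_append, iter.injEq] at h ⊢
      obtain ⟨h₁, h₂⟩ := ih h.1
      exact ⟨h₁, by rw [h₂, h.2]⟩

theorem cell_ne_prod {ℓ : Loc} {o : List ℕ} {a b : Nm Loc Stmt A} : cell ℓ o ≠ prod a b := by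
  rcases List.eq_nil_or_concat o with rfl | ⟨q, j, rfl⟩
  · simp [cell]
  · simp [List.concat_eq_append, cell_append]

theorem primes_cell (ℓ : Loc) (o : List ℕ) : (cell ℓ o : Nm Loc Stmt A).primes = o.length := by
  induction o using List.reverseRecOn with
  | nil => rfl
  | append_singleton o i ih => simp [cell_append, primes, ih]

theorem incr_cell (d : ℕ) (ℓ : Loc) (o : List ℕ) :
    (cell ℓ o : Nm Loc Stmt A).incr d = cell ℓ (o.modify d (· + 1)) := by
  induction o using List.reverseRecOn with
  | nil => simp [cell, incr]
  | append_singleton o i ih =>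
    rw [cell_append, incr, primes_cell]
    split_ifs with h
    · subst h
      rw [← cell_append, modify_append_length]
    · rw [ih, ← cell_append]
      congr 1
      rcases lt_or_gt_of_ne h with h | h
      · rw [List.modify_eq_self (by omega), List.modify_eq_self (by simp; omega)]
      · rw [modify_append_of_lt h]

theorem memo_inj {f f' : Fn} {vs vs' : List (Val Stmt A)}
    (h : (memo f vs : Nm Loc Stmt A) = memo f' vs') : f = f' ∧ vs = vs' := by
  induction vs using List.reverseRecOn generalizing vs' with
  | nil =>
    rcases List.eq_nil_or_concat vs' with rfl | ⟨q, j, rfl⟩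
    · simpa [memo] using h
    · simp [memo] at h
  | append_singleton o i ih =>
    rcases List.eq_nil_or_concat vs' with rfl | ⟨q, j, rfl⟩
    · simp [memo] at h
    · simp only [memo, List.concat_eq_append, List.foldl_append, List.foldl_cons, List.foldl_nil,
        prod.injEq, val.injEq] at h
      obtain ⟨h₁, h₂⟩ := ih h.1
      exact ⟨h₁, by rw [h₂, h.2, List.concat_eq_append]⟩

end Nm

namespace Program

variable {Loc Stmt A : Type*} {P : Program Loc Stmt}

theorem entryName_of_isHead {ℓ : Loc} {o : List ℕ} (h : P.IsHead ℓ) :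
    (P.entryName ℓ o : Nm Loc Stmt A) = .cell ℓ (o ++ [0]) := by
  rw [entryName, if_pos h, Nm.cell_append]

theorem entryName_of_not_isHead {ℓ : Loc} {o : List ℕ} (h : ¬ P.IsHead ℓ) :
    (P.entryName ℓ o : Nm Loc Stmt A) = .cell ℓ o := by
  rw [entryName, if_neg h]

theorem exists_entryName_eq_cell (ℓ : Loc) (o : List ℕ) :
    ∃ p, (P.entryName ℓ o : Nm Loc Stmt A) = .cell ℓ p := by
  by_cases h : P.IsHead ℓ
  · exact ⟨_, entryName_of_isHead h⟩
  · exact ⟨_, entryName_of_not_isHead h⟩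

theorem entryName_ne_prod {ℓ : Loc} {o : List ℕ} {a b : Nm Loc Stmt A} :
    P.entryName ℓ o ≠ .prod a b := by
  obtain ⟨p, hp⟩ := exists_entryName_eq_cell (P := P) (Stmt := Stmt) (A := A) ℓ o
  rw [hp]
  exact Nm.cell_ne_prod

theorem entryName_inj {ℓ ℓ' : Loc} {o o' : List ℕ}
    (h : (P.entryName ℓ o : Nm Loc Stmt A) = P.entryName ℓ' o') : ℓ = ℓ' ∧ o = o' := by
  have hl : ℓ = ℓ' := by
    obtain ⟨p, hp⟩ := exists_entryName_eq_cell (P := P) (Stmt := Stmt) (A := A) ℓ o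
    obtain ⟨q, hq⟩ := exists_entryName_eq_cell (P := P) (Stmt := Stmt) (A := A) ℓ' o'
    rw [hp, hq] at h
    exact (Nm.cell_inj h).1
  subst hl
  refine ⟨rfl, ?_⟩
  by_cases hh : P.IsHead ℓ
  · rw [entryName_of_isHead hh, entryName_of_isHead hh] at h
    simpa using (Nm.cell_inj h).2
  · rw [entryName_of_not_isHead hh, entryName_of_not_isHead hh] at h
    exact (Nm.cell_inj h).2

theorem mem_fwdInto {ℓ : Loc} {e : Edge Loc Stmt} :
    e ∈ P.fwdInto ℓ ↔ P.FwdEdge e ∧ e.dst = ℓ := by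
  simp only [fwdInto, Finset.mem_filter, and_iff_right_iff_imp]
  exact fun h => h.1.1

theorem fwdEdgesTo_getElem? {ℓ : Loc} {i : ℕ} {e : Edge Loc Stmt}
    (h : (P.fwdEdgesTo ℓ)[i]? = some e) : P.FwdEdge e ∧ e.dst = ℓ :=
  mem_fwdInto.1 (Finset.mem_toList.1 (List.mem_of_getElem? h))

theorem FwdEdge.fwdInto_eq {e : Edge Loc Stmt} (he : P.FwdEdge e) (hj : ¬ P.IsJoin e.dst) :
    P.fwdInto e.dst = {e} := by
  have hm : e ∈ P.fwdInto e.dst := mem_fwdInto.2 ⟨he, rfl⟩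
  have hc : (P.fwdInto e.dst).card ≤ 1 := by
    simpa [IsJoin, fwdEdgesTo, Nat.lt_succ_iff] using hj
  exact Finset.eq_singleton_iff_unique_mem.2 ⟨hm, fun x hx => Finset.card_le_one.1 hc x hx e hm⟩

end Program

end Demanded

namespace Demanded

variable {Loc Stmt A : Type*} [SemilatticeSup A] [OrderBot A]
  {P : Program Loc Stmt} {I : AbstractInterpreter Stmt A}

/-! ### Determinism of the batch analysis -/

namespace Batch

/-- At most one result of the batch analysis for the goal `g`. -/
def Unique (P : Program Loc Stmt) (I : AbstractInterpreter Stmt A) (g : Goal Loc A) : Prop :=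
  ∀ x x', Batch P I g x → Batch P I g x' → x = x'

/-- Uniqueness of the results for `g`.  For the iterate `i` at a loop head, this includes the
uniqueness of all earlier iterates and of the passes over the body that start from them. -/
def Determined (P : Program Loc Stmt) (I : AbstractInterpreter Stmt A) : Goal Loc A → Prop
  | .iterate h y₀ i => (∀ j ≤ i, Unique P I (.iterate h y₀ j)) ∧
      ∀ j < i, ∀ x, Batch P I (.iterate h y₀ j) x → ∀ e, P.BackEdge e → e.dst = h →
        Unique P I (.at (some (h, x)) e.src)
  | g => Unique P I g

theorem next_inv {h : Loc} {y₀ z : A} {i : ℕ} (hz : Batch P I (.iterate h y₀ (i + 1)) z) :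
    ∃ e y φ, P.BackEdge e ∧ e.dst = h ∧ Batch P I (.iterate h y₀ i) y ∧
      Batch P I (.at (some (h, y)) e.src) φ ∧ z = I.widen y (I.transfer e.stmt φ) := by
  cases hz with
  | next he hd hy hφ => exact ⟨_, _, _, he, hd, hy, hφ, rfl⟩

/-- Once two consecutive iterates at a loop head are equal, all later iterates are equal. -/
theorem iterate_eq_of_stable (hP : P.WellFormed) {h : Loc} {y₀ x : A} {j : ℕ}
    (hj : Unique P I (.iterate h y₀ j)) (hj' : Unique P I (.iterate h y₀ (j + 1)))
    (hb : ∀ e, P.BackEdge e → e.dst = h → Unique P I (.at (some (h, x)) e.src))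
    (h₁ : Batch P I (.iterate h y₀ j) x) (h₂ : Batch P I (.iterate h y₀ (j + 1)) x)
    {m : ℕ} (hm : j ≤ m) {z : A} (hz : Batch P I (.iterate h y₀ m) z) : z = x := by
  induction m, hm using Nat.le_induction generalizing z with
  | base => exact hj _ _ hz h₁
  | succ m hm ih =>
    rcases hm.eq_or_lt with rfl | hm
    · exact hj' _ _ hz h₂
    obtain ⟨e, y, φ, he, hd, hy, hφ, rfl⟩ := hz.next_inv
    obtain rfl := ih hy
    obtain ⟨e', y', φ', he', hd', hy', hφ', hw⟩ := h₂.next_inv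
    obtain rfl := hj _ _ h₁ hy'
    obtain rfl := hP.back_unique _ _ he he' (hd.trans hd'.symm)
    rw [hb _ he hd _ _ hφ hφ']
    exact hw.symm

theorem determined (hP : P.WellFormed) {g : Goal Loc A} {φ : A} (hg : Batch P I g φ) :
    Determined P I g := by
  induction hg with
  | held =>
    intro x x' h h'
    have key : ∀ {h : Loc} {y z : A}, Batch P I (.at (some (h, y)) h) z → z = y := by
      intro h y z hz
      cases hz with
      | held => rfl
      | plain hn => exact (hn _ rfl).elim
      | stable hn => exact (hn _ rfl).elim
    rw [key h, key h']
  | plain hn hh _ ih =>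
    intro x x' h h'
    cases h with
    | held => exact (hn _ rfl).elim
    | stable _ hh' => exact (hh hh').elim
    | plain _ _ h =>
      cases h' with
      | held => exact (hn _ rfl).elim
      | stable _ hh' => exact (hh hh').elim
      | plain _ _ h' => exact ih _ _ h h'
  | @stable held ℓ y₀ φ i hn hh he hi hi' ihe _ ih' =>
    have key : ∀ {x : A}, Batch P I (.at held ℓ) x → x = φ := by
      intro x hx
      cases hx with
      | held => exact (hn _ rfl).elim
      | plain _ hh' => exact (hh' hh).elim
      | @stable _ _ _ _ j _ _ he₁ h₁ h₂ =>
        obtain rfl := ihe _ _ he he₁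
        rcases le_or_gt j i with hji | hji
        · exact (iterate_eq_of_stable hP (ih'.1 _ (by omega)) (ih'.1 _ (by omega))
            (ih'.2 j (by omega) _ h₁) h₁ h₂ hji hi).symm
        · exact iterate_eq_of_stable hP (ih'.1 _ (by omega)) (ih'.1 _ (by omega))
            (ih'.2 i (by omega) _ hi) hi hi' hji.le h₁
    intro x x' h h'
    rw [key h, key h']
  | start =>
    intro x x' h h'
    cases h with
    | flow _ hne => exact (hne rfl).elim
    | start =>
      cases h' with
      | flow _ hne => exact (hne rfl).elim
      | start => rfl
  | flow _ hne _ ih =>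
    intro x x' h h'
    cases h with
    | start => exact (hne rfl).elim
    | flow _ _ h =>
      cases h' with
      | start => exact (hne rfl).elim
      | flow _ _ h' =>
        exact Finset.sup_congr rfl fun e he => by rw [ih e he _ _ (h e he) (h' e he)]
  | first =>
    refine ⟨fun j hj x x' h h' => ?_, fun j hj => by omega⟩
    obtain rfl : j = 0 := by omega
    cases h; cases h'; rfl
  | @next h y₀ y φ i e he hd hy _ ihy ihb =>
    have hb : ∀ x, Batch P I (.iterate h y₀ i) x → ∀ e, P.BackEdge e → e.dst = h →
        Unique P I (.at (some (h, x)) e.src) := by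
      intro x hx e' he' hd'
      obtain rfl := hP.back_unique _ _ he he' (hd.trans hd'.symm)
      obtain rfl := ihy.1 i le_rfl _ _ hy hx
      exact ihb
    refine ⟨fun j hj => ?_, fun j hj => ?_⟩
    · rcases Nat.lt_or_ge i j with hij | hij
      · obtain rfl : j = i + 1 := by omega
        intro x x' h h'
        cases h with
        | next he₁ hd₁ hy₁ hb₁ =>
          cases h' with
          | next he₂ hd₂ hy₂ hb₂ =>
            obtain rfl := ihy.1 i le_rfl _ _ hy₁ hy₂
            obtain rfl := hP.back_unique _ _ he₁ he₂ (hd₁.trans hd₂.symm)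
            rw [hb _ hy₁ _ he₁ hd₁ _ _ hb₁ hb₂]
      · exact ihy.1 j hij
    · rcases Nat.lt_or_ge j i with hij | hij
      · exact ihy.2 j hij
      · obtain rfl : j = i := by omega
        exact hb

theorem unique (hP : P.WellFormed) {g : Goal Loc A} {φ φ' : A} (h : Batch P I g φ)
    (h' : Batch P I g φ') : φ = φ' := by
  have hd := h.determined hP
  rcases g with _ | _ | _
  exacts [hd _ _ h h', hd _ _ h h', hd.1 _ le_rfl _ _ h h']

end Batch

end Demanded

namespace Demanded

variable {Loc Stmt A : Type*} [SemilatticeSup A] [OrderBot A]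
  {P : Program Loc Stmt} {I : AbstractInterpreter Stmt A}

/-! ### The batch meaning of DAIG names -/

/-- `Held P I ℓ o hd`: within the iterations `o` of the loops around `ℓ`, the innermost loop that
contains `ℓ` as a non-head is analysed with its head held as recorded by `hd`; that is, the last
entry `i` of `o` is replaced by the `i`th iterate at that head. -/
inductive Held (P : Program Loc Stmt) (I : AbstractInterpreter Stmt A) :
    Loc → List ℕ → Option (Loc × A) → Prop where
  | top {ℓ : Loc} : (∀ h, ¬ P.Encloses h ℓ) → Held P I ℓ [] none
  | inner {h ℓ : Loc} {o : List ℕ} {i : ℕ} {hd : Option (Loc × A)} {y x : A} :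
      P.Innermost h ℓ → Held P I h o hd → Batch P I (.entry hd h) y →
      Batch P I (.iterate h y i) x → Held P I ℓ (o ++ [i]) (some (h, x))

namespace Held

theorem anyCtx {ℓ : Loc} {o : List ℕ} {hd : Option (Loc × A)} (h : Held P I ℓ o hd) :
    P.AnyCtx ℓ o := by
  induction h with
  | top hn => exact .top hn
  | inner hi _ _ _ ih => exact .inner hi ih trivial

theorem ne_some {ℓ : Loc} {o : List ℕ} {hd : Option (Loc × A)} (h : Held P I ℓ o hd) (x : A) :
    hd ≠ some (ℓ, x) := by
  cases h with
  | top => simp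
  | inner hi =>
    intro h
    simp only [Option.some.injEq, Prod.mk.injEq] at h
    exact hi.1.2 h.1.symm

theorem inner_inv (hP : P.WellFormed) {g ℓ : Loc} {o : List ℕ} {i : ℕ} {hd : Option (Loc × A)}
    (hg : P.Innermost g ℓ) (h : Held P I ℓ (o ++ [i]) hd) :
    ∃ hd' y x, Held P I g o hd' ∧ Batch P I (.entry hd' g) y ∧
      Batch P I (.iterate g y i) x ∧ hd = some (g, x) := by
  generalize hp : o ++ [i] = p at h
  cases h with
  | top => simp at hp
  | @inner g' _ o' i' hd' y x hi h he hx =>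
    obtain ⟨rfl, hii⟩ := List.append_inj' hp rfl
    simp only [List.cons.injEq, and_true] at hii
    subst hii
    obtain rfl := hg.unique hP hi
    exact ⟨_, _, _, h, he, hx, rfl⟩

theorem unique (hP : P.WellFormed) {ℓ : Loc} {o : List ℕ} {hd hd' : Option (Loc × A)}
    (h : Held P I ℓ o hd) (h' : Held P I ℓ o hd') : hd = hd' := by
  induction h generalizing hd' with
  | top hn =>
    generalize hp : ([] : List ℕ) = p at h'
    cases h' with
    | top => rfl
    | inner => simp at hp
  | inner hi _ he hx ih =>
    obtain ⟨hd₂, y₂, x₂, h₂, he₂, hx₂, rfl⟩ := h'.inner_inv hP hi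
    obtain rfl := ih h₂
    obtain rfl := he.unique hP he₂
    rw [hx.unique hP hx₂]

theorem congr {a b : Loc} (hab : ∀ g, P.Encloses g a ↔ P.Encloses g b) {o : List ℕ}
    {hd : Option (Loc × A)} (h : Held P I a o hd) : Held P I b o hd := by
  cases h with
  | top hn => exact .top fun g hg => hn g ((hab g).2 hg)
  | inner hi h he hx => exact .inner ((Program.innermost_congr hab).1 hi) h he hx

end Held

/-- `Denotes P I n v`: the value `v` is the one that the batch analysis assigns to the name `n`.
States at locations are results of `Goal.at`, the iterates at a loop head are results of
`Goal.iterate`, and the names of pre-join and pre-widen states denote transferred states of the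
source of the edge. -/
inductive Denotes (P : Program Loc Stmt) (I : AbstractInterpreter Stmt A) :
    Nm Loc Stmt A → Val Stmt A → Prop where
  | stmt {r : Ref Loc Stmt A} {v : Val Stmt A} :
      P.StmtCell r → r.val = some v → Denotes P I r.name v
  | node {ℓ : Loc} {o : List ℕ} {hd : Option (Loc × A)} {φ : A} :
      Held P I ℓ o hd → Batch P I (.at hd ℓ) φ → Denotes P I (.cell ℓ o) (.state φ)
  | iterate {h : Loc} {o : List ℕ} {i : ℕ} {hd : Option (Loc × A)} {y x : A} :
      P.IsHead h → Held P I h o hd → Batch P I (.entry hd h) y → Batch P I (.iterate h y i) x →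
      Denotes P I (.cell h (o ++ [i])) (.state x)
  | preJoin {ℓ : Loc} {o : List ℕ} {hd : Option (Loc × A)} {i : ℕ} {e : Edge Loc Stmt} {φ : A} :
      Held P I ℓ o hd → (P.fwdEdgesTo ℓ)[i]? = some e → Batch P I (.at hd e.src) φ →
      Denotes P I (.prod (.int (i + 1)) (P.entryName ℓ o)) (.state (I.transfer e.stmt φ))
  | preWiden {e : Edge Loc Stmt} {o : List ℕ} {i : ℕ} {hd : Option (Loc × A)} {y x φ : A} :
      P.BackEdge e → Held P I e.dst o hd → Batch P I (.entry hd e.dst) y →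
      Batch P I (.iterate e.dst y i) x → Batch P I (.at (some (e.dst, x)) e.src) φ →
      Denotes P I (.prod (.cell e.dst (o ++ [i])) (.cell e.dst (o ++ [i + 1])))
        (.state (I.transfer e.stmt φ))

namespace Denotes

theorem cell_inv {ℓ : Loc} {o : List ℕ} {v : Val Stmt A} (h : Denotes P I (.cell ℓ o) v) :
    (∃ hd φ, v = .state φ ∧ Held P I ℓ o hd ∧ Batch P I (.at hd ℓ) φ) ∨
    ∃ p i hd y x, o = p ++ [i] ∧ v = .state x ∧ P.IsHead ℓ ∧ Held P I ℓ p hd ∧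
      Batch P I (.entry hd ℓ) y ∧ Batch P I (.iterate ℓ y i) x := by
  generalize hn : (Nm.cell ℓ o : Nm Loc Stmt A) = n at h
  cases h with
  | stmt hr =>
    cases hr <;> exact (Nm.cell_ne_prod hn).elim
  | node h hb =>
    obtain ⟨rfl, rfl⟩ := Nm.cell_inj hn
    exact .inl ⟨_, _, rfl, h, hb⟩
  | iterate hh h he hx =>
    obtain ⟨rfl, rfl⟩ := Nm.cell_inj hn
    exact .inr ⟨_, _, _, _, _, rfl, rfl, hh, h, he, hx⟩
  | preJoin => exact (Nm.cell_ne_prod hn).elim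
  | preWiden => exact (Nm.cell_ne_prod hn).elim

theorem edge_inv {e : Edge Loc Stmt} (he : P.FwdEdge e ∧ ¬ P.IsJoin e.dst ∨ P.BackEdge e)
    (hP : P.WellFormed) {v : Val Stmt A}
    (h : Denotes P I (.prod (.loc e.src) (.loc e.dst)) v) : v = .stmt e.stmt := by
  generalize hn : (.prod (.loc e.src) (.loc e.dst) : Nm Loc Stmt A) = n at h
  cases h with
  | stmt hr hv =>
    have key : ∀ e' : Edge Loc Stmt, P.FwdEdge e' ∧ ¬ P.IsJoin e'.dst ∨ P.BackEdge e' →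
        e.src = e'.src → e.dst = e'.dst → e = e' := by
      intro e' he' hs hd
      rcases he with he | he <;> rcases he' with he' | he'
      · have := he.1.fwdInto_eq he.2
        rw [hd, he'.1.fwdInto_eq he'.2] at this
        exact (Finset.singleton_inj.1 this).symm
      · exact (he.1.2 (hs ▸ hd ▸ he'.2)).elim
      · exact (he'.1.2 (hs ▸ hd ▸ he.2)).elim
      · exact hP.back_unique _ _ he he' hd
    cases hr with
    | fwd h hj =>
      simp only [Nm.prod.injEq, Nm.loc.injEq] at hn
      rw [key _ (.inl ⟨h, hj⟩) hn.1 hn.2]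
      exact (Option.some.inj hv).symm
    | join => simp at hn
    | back h =>
      simp only [Nm.prod.injEq, Nm.loc.injEq] at hn
      rw [key _ (.inr h) hn.1 hn.2]
      exact (Option.some.inj hv).symm
  | node => exact (Nm.cell_ne_prod hn.symm).elim
  | iterate => exact (Nm.cell_ne_prod hn.symm).elim
  | preJoin => simp at hn
  | preWiden => simp [Nm.cell_append] at hn

theorem joinEdge_inv {ℓ : Loc} {i : ℕ} {e : Edge Loc Stmt}
    (he : (P.fwdEdgesTo ℓ)[i]? = some e) {v : Val Stmt A}
    (h : Denotes P I (.prod (.int (i + 1)) (.prod (.loc e.src) (.loc ℓ))) v) :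
    v = .stmt e.stmt := by
  generalize hn : (.prod (.int (i + 1)) (.prod (.loc e.src) (.loc ℓ)) : Nm Loc Stmt A) = n at h
  cases h with
  | stmt hr hv =>
    cases hr with
    | fwd => simp at hn
    | join _ he' =>
      simp only [Nm.prod.injEq, Nm.loc.injEq, Nm.int.injEq, add_left_inj] at hn
      obtain ⟨rfl, -, rfl⟩ := hn
      obtain rfl := Option.some.inj (he.symm.trans he')
      exact (Option.some.inj hv).symm
    | back => simp at hn
  | node => exact (Nm.cell_ne_prod hn.symm).elim
  | iterate => exact (Nm.cell_ne_prod hn.symm).elim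
  | preJoin =>
    simp only [Nm.prod.injEq] at hn
    exact (Program.entryName_ne_prod hn.2.symm).elim
  | preWiden => simp [Nm.cell_append] at hn

theorem preJoin_inv {ℓ : Loc} {o : List ℕ} {i : ℕ} {v : Val Stmt A}
    (h : Denotes P I (.prod (.int (i + 1)) (P.entryName ℓ o)) v) :
    ∃ hd e φ, v = .state (I.transfer e.stmt φ) ∧ Held P I ℓ o hd ∧
      (P.fwdEdgesTo ℓ)[i]? = some e ∧ Batch P I (.at hd e.src) φ := by
  generalize hn : (.prod (.int (i + 1)) (P.entryName ℓ o) : Nm Loc Stmt A) = n at h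
  cases h with
  | stmt hr hv =>
    cases hr with
    | fwd => simp at hn
    | join =>
      simp only [Nm.prod.injEq] at hn
      exact (Program.entryName_ne_prod hn.2).elim
    | back => simp at hn
  | node => exact (Nm.cell_ne_prod hn.symm).elim
  | iterate => exact (Nm.cell_ne_prod hn.symm).elim
  | preJoin h he hb =>
    simp only [Nm.prod.injEq, Nm.int.injEq, add_left_inj] at hn
    obtain ⟨rfl, hn⟩ := hn
    obtain ⟨rfl, rfl⟩ := Program.entryName_inj hn
    exact ⟨_, _, _, rfl, h, he, hb⟩
  | preWiden => simp [Nm.cell_append] at hn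

theorem preWiden_inv {h : Loc} {o : List ℕ} {i : ℕ} {v : Val Stmt A}
    (hv : Denotes P I (.prod (.cell h (o ++ [i])) (.cell h (o ++ [i + 1]))) v) :
    ∃ e hd y x φ, v = .state (I.transfer e.stmt φ) ∧ P.BackEdge e ∧ e.dst = h ∧
      Held P I h o hd ∧ Batch P I (.entry hd h) y ∧ Batch P I (.iterate h y i) x ∧
      Batch P I (.at (some (h, x)) e.src) φ := by
  generalize hn :
    (.prod (.cell h (o ++ [i])) (.cell h (o ++ [i + 1])) : Nm Loc Stmt A) = n at hv
  cases hv with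
  | stmt hr hv =>
    cases hr <;> simp [Nm.cell_append] at hn
  | node => exact (Nm.cell_ne_prod hn.symm).elim
  | iterate => exact (Nm.cell_ne_prod hn.symm).elim
  | preJoin h he hb => simp [Nm.cell_append] at hn
  | preWiden he h hy hx hφ =>
    simp only [Nm.prod.injEq] at hn
    obtain ⟨rfl, ho⟩ := Nm.cell_inj hn.1
    obtain ⟨rfl, hi⟩ := List.append_inj' ho rfl
    simp only [List.cons.injEq, and_true] at hi
    subst hi
    exact ⟨_, _, _, _, _, rfl, he, rfl, h, hy, hx, hφ⟩

/-- The cell that represents the source of a forward edge holds the state at the source, as seen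
by the analysis of the loop around the destination. -/
theorem fwd_source (hP : P.WellFormed) {e : Edge Loc Stmt} (he : P.FwdEdge e) {o : List ℕ}
    (ho : P.AnyCtx e.dst o) {v : Val Stmt A} (hv : Denotes P I (.cell e.src o) v) :
    ∃ hd φ, v = .state φ ∧ Held P I e.dst o hd ∧ Batch P I (.at hd e.src) φ := by
  rcases hv.cell_inv with ⟨hd, φ, rfl, h, hb⟩ | ⟨p, i, hd, y, x, rfl, rfl, -, h, hy, hx⟩ <;>
    rcases he.enclosing hP with hc | hi
  · exact ⟨hd, φ, rfl, h.congr hc, hb⟩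
  · obtain ⟨q, j, rfl, hq⟩ := ho.of_innermost hP hi
    exact (hq.append_false hP h.anyCtx).elim
  · exact ((h.congr hc).anyCtx.append_false hP ho).elim
  · exact ⟨_, x, rfl, .inner hi h hy hx, .held⟩

/-- The cell that represents the source of a back edge in iteration `i` holds the result of the pass
over the loop body that starts from the iterate `i`. -/
theorem back_source (hP : P.WellFormed) {e : Edge Loc Stmt} (he : P.BackEdge e) {o : List ℕ}
    (ho : P.AnyCtx e.dst o) {i : ℕ} {v : Val Stmt A}
    (hv : Denotes P I (.cell e.src (o ++ [i])) v) :
    ∃ hd y x φ, v = .state φ ∧ Held P I e.dst o hd ∧ Batch P I (.entry hd e.dst) y ∧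
      Batch P I (.iterate e.dst y i) x ∧ Batch P I (.at (some (e.dst, x)) e.src) φ := by
  by_cases hs : e.src = e.dst
  · rw [hs] at hv ⊢
    rcases hv.cell_inv with ⟨hd, φ, rfl, h, hb⟩ | ⟨p, j, hd, y, x, hp, rfl, -, h, hy, hx⟩
    · exact (ho.append_false hP h.anyCtx).elim
    · obtain ⟨rfl, hi⟩ := List.append_inj' hp rfl
      simp only [List.cons.injEq, and_true] at hi
      subst hi
      exact ⟨_, _, _, _, rfl, h, hy, hx, .held⟩
  · have hi := he.innermost hP hs
    rcases hv.cell_inv with ⟨hd, φ, rfl, h, hb⟩ | ⟨p, j, hd, y, x, hp, rfl, -, h, hy, hx⟩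
    · obtain ⟨hd', y, x, h', hy, hx, rfl⟩ := h.inner_inv hP hi
      exact ⟨_, _, _, _, rfl, h', hy, hx, hb⟩
    · obtain ⟨rfl, -⟩ := List.append_inj' hp rfl
      have := ho.length_lt hP h.anyCtx hi.1
      exact (lt_irrefl _ this).elim

theorem iterate_inv (hP : P.WellFormed) {h : Loc} {o : List ℕ} (ho : P.AnyCtx h o) {i : ℕ}
    {v : Val Stmt A} (hv : Denotes P I (.cell h (o ++ [i])) v) :
    ∃ hd y x, v = .state x ∧ Held P I h o hd ∧ Batch P I (.entry hd h) y ∧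
      Batch P I (.iterate h y i) x := by
  rcases hv.cell_inv with ⟨hd, φ, rfl, h, hb⟩ | ⟨p, j, hd, y, x, hp, rfl, -, h, hy, hx⟩
  · exact (ho.append_false hP h.anyCtx).elim
  · obtain ⟨rfl, hi⟩ := List.append_inj' hp rfl
    simp only [List.cons.injEq, and_true] at hi
    subst hi
    exact ⟨_, _, _, rfl, h, hy, hx⟩

/-- The entry cell of a location holds the state that flows into it. -/
theorem of_entry {ℓ : Loc} {o : List ℕ} {hd : Option (Loc × A)} {φ : A} (h : Held P I ℓ o hd)
    (hb : Batch P I (.entry hd ℓ) φ) : Denotes P I (P.entryName ℓ o) (.state φ) := by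
  by_cases hh : P.IsHead ℓ
  · rw [Program.entryName_of_isHead hh]
    exact .iterate hh h hb .first
  · rw [Program.entryName_of_not_isHead hh]
    exact .node h (.plain h.ne_some hh hb)

theorem init : Denotes P I (P.entryName P.entry []) (.state I.init) :=
  of_entry (.top Program.not_encloses_entry) .start

end Denotes

theorem AbstractInterpreter.yields_transfer_inv {v w u : Val Stmt A} {s : Stmt} {φ : A}
    (h : I.Yields .transfer [v, w] u) (hv : v = .stmt s) (hw : w = .state φ) :
    u = .state (I.transfer s φ) := by
  subst hv hw
  obtain ⟨_, h, rfl⟩ := h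
  rw [← Option.some.inj h]

theorem foldStates_states {S B : Type*} (op : B → B → B) (φ : B) (φs : List B) :
    foldStates op ((φ :: φs).map Val.state : List (Val S B)) = some (φs.foldl op φ) := by
  simp only [foldStates, List.map_cons]
  induction φs generalizing φ with
  | nil => rfl
  | cons ψ φs ih => simpa using ih (op φ ψ)

theorem AbstractInterpreter.yields_join_inv {φs : List A} {v : Val Stmt A}
    (h : I.Yields .join (φs.map Val.state) v) : v = .state (φs.foldr (· ⊔ ·) ⊥) := by
  obtain ⟨φ, h, rfl⟩ := h
  cases φs with
  | nil => simp [apply, foldStates] at h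
  | cons ψ φs =>
    rw [apply, foldStates_states] at h
    · obtain rfl := Option.some.inj h
      congr 1
      clear h
      have : ∀ (χ : A) (l : List A), l.foldl (· ⊔ ·) χ = χ ⊔ l.foldr (· ⊔ ·) ⊥ := by
        intro χ l
        induction l generalizing χ with
        | nil => simp
        | cons a l ih => simp [ih, sup_assoc]
      exact this ψ φs

open Program in
/-- The computations of a DAIG compute the results of the batch analysis. -/
theorem Denotes.of_encoded (hP : P.WellFormed) {c : Comp Loc Stmt A} (hc : P.Encoded c)
    {vs : List (Val Stmt A)} {v : Val Stmt A} (hs : List.Forall₂ (Denotes P I) c.srcs vs)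
    (hv : I.Yields c.fn vs v) : Denotes P I c.dest v := by
  cases hc with
  | @transfer e o he hj ho =>
    obtain _ | ⟨h₁, _ | ⟨h₂, _ | _⟩⟩ := hs
    obtain ⟨hd, φ, hφ, h, hb⟩ := h₂.fwd_source hP he ho
    rw [AbstractInterpreter.yields_transfer_inv hv (h₁.edge_inv (.inl ⟨he, hj⟩) hP) hφ]
    refine .of_entry h ?_
    have := Batch.flow (P := P) (I := I) (w := fun _ => φ) (hP.edges_mem e he.1).2
      he.dst_ne_entry (held := hd) (fun e' he' => by
        rw [he.fwdInto_eq hj, Finset.mem_singleton] at he'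
        exact he' ▸ hb)
    rwa [he.fwdInto_eq hj, Finset.sup_singleton] at this
  | @preJoin ℓ i e o hj he ho =>
    obtain ⟨he', rfl⟩ := fwdEdgesTo_getElem? he
    obtain _ | ⟨h₁, _ | ⟨h₂, _ | _⟩⟩ := hs
    obtain ⟨hd, φ, hφ, h, hb⟩ := h₂.fwd_source hP he' ho
    rw [AbstractInterpreter.yields_transfer_inv hv (h₁.joinEdge_inv he) hφ]
    exact .preJoin h he hb
  | @join ℓ o hj ho =>
    rw [List.forall₂_map_left_iff, List.forall₂_iff_get] at hs
    obtain ⟨hl, hs⟩ := hs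
    simp only [List.length_range, List.get_eq_getElem, List.getElem_range] at hl hs
    have hpos : 0 < (P.fwdEdgesTo ℓ).length := lt_of_lt_of_le two_pos hj
    obtain ⟨hd, -, -, -, h, -, -⟩ := (hs 0 hpos (hl ▸ hpos)).preJoin_inv
    have hb : ∀ e : Edge Loc Stmt, ∃ φ : A, ∀ i : ℕ, (P.fwdEdgesTo ℓ)[i]? = some e →
        vs[i]? = some (Val.state (I.transfer e.stmt φ)) ∧ Batch P I (.at hd e.src) φ := by
      intro e
      by_cases hex : ∃ i : ℕ, (P.fwdEdgesTo ℓ)[i]? = some e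
      · have key : ∀ i : ℕ, (P.fwdEdgesTo ℓ)[i]? = some e → ∃ φ : A,
            vs[i]? = some (Val.state (I.transfer e.stmt φ)) ∧ Batch P I (.at hd e.src) φ := by
          intro i hi
          have hlt := (List.getElem?_eq_some_iff.1 hi).1
          obtain ⟨hd', e', φ, hφ, h', he', hb⟩ := (hs i hlt (hl ▸ hlt)).preJoin_inv
          obtain rfl := h.unique hP h'
          obtain rfl := Option.some.inj (hi.symm.trans he')
          exact ⟨φ, by rw [List.getElem?_eq_getElem (hl ▸ hlt), hφ], hb⟩
        obtain ⟨i, hi⟩ := hex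
        obtain ⟨φ, -, hb⟩ := key i hi
        refine ⟨φ, fun j hj => ?_⟩
        obtain ⟨φ', hv', hb'⟩ := key j hj
        obtain rfl := hb.unique hP hb'
        exact ⟨hv', hb'⟩
      · exact ⟨⊥, fun i hi => (hex ⟨i, hi⟩).elim⟩
    choose w hw using hb
    -- the sources hold the transferred states in the order of `fwdEdgesTo`
    have hvs : vs = ((P.fwdEdgesTo ℓ).map fun e => I.transfer e.stmt (w e)).map Val.state := by
      refine List.ext_getElem (by simpa using hl.symm) fun i h₁ h₂ => ?_
      have := (hw _ i (List.getElem?_eq_getElem (hl.symm ▸ h₁))).1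
      rw [List.getElem?_eq_getElem h₁] at this
      simpa using this
    subst hvs
    obtain ⟨e, he⟩ := List.exists_mem_of_length_pos hpos
    have hmem : ∀ {e}, e ∈ P.fwdInto ℓ ↔ e ∈ P.fwdEdgesTo ℓ := Finset.mem_toList.symm
    obtain ⟨he', rfl⟩ := mem_fwdInto.1 (hmem.2 he)
    rw [AbstractInterpreter.yields_join_inv hv]
    refine .of_entry h ?_
    have := Batch.flow (P := P) (I := I) (w := w) (hP.edges_mem e he'.1).2
      he'.dst_ne_entry (held := hd) (fun e' he' => by
        obtain ⟨i, hi⟩ := List.getElem?_of_mem (hmem.1 he')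
        exact (hw _ i hi).2)
    rwa [Finset.sup_def, ← Finset.coe_toList, Multiset.map_coe, Multiset.sup_coe] at this
  | @back e o i he ho _ =>
    obtain _ | ⟨h₁, _ | ⟨h₂, _ | _⟩⟩ := hs
    obtain ⟨hd, y, x, φ, hφ, h, hy, hx, hb⟩ := h₂.back_source hP he ho
    rw [AbstractInterpreter.yields_transfer_inv hv (h₁.edge_inv (.inr he) hP) hφ]
    simp only [← Nm.cell_append]
    exact .preWiden he h hy hx hb
  | @widen h o i hh ho _ =>
    obtain _ | ⟨h₁, _ | ⟨h₂, _ | _⟩⟩ := hs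
    simp only [← Nm.cell_append] at h₁ h₂ ⊢
    obtain ⟨hd, y, x, rfl, hh₁, hy, hx⟩ := h₁.iterate_inv hP ho
    obtain ⟨e, hd', y', x', φ, rfl, he, rfl, hh₂, hy', hx', hb⟩ := h₂.preWiden_inv
    obtain rfl := hh₁.unique hP hh₂
    obtain rfl := hy.unique hP hy'
    obtain rfl := hx.unique hP hx'
    obtain ⟨_, hv, rfl⟩ := hv
    rw [← Option.some.inj hv]
    exact .iterate hh hh₁ hy (.next he rfl hx hb)
  | @fix h o k hh ho _ =>
    obtain rfl : vs = [v, v] := hv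
    obtain _ | ⟨h₁, _ | ⟨h₂, _ | _⟩⟩ := hs
    simp only [← Nm.cell_append] at h₁ h₂ ⊢
    obtain ⟨hd, y, x, rfl, hh₁, hy, hx⟩ := h₁.iterate_inv hP ho
    obtain ⟨hd', y', x', hxx, hh₂, hy', hx'⟩ := h₂.iterate_inv hP ho
    obtain rfl := hh₁.unique hP hh₂
    obtain rfl := hy.unique hP hy'
    obtain rfl : x = x' := by simpa using hxx
    exact .node hh₁ (.stable hh₁.ne_some hh hy hx hx')

end Demanded

namespace Demanded

/-! ### Well-foundedness of the dependencies -/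

namespace Program

variable {Loc Stmt A : Type*} {P : Program Loc Stmt}

/-- Well-founded induction on locations: the claim for `ℓ` may use the claim for its forward
predecessors at the same nesting level, and for the source of the back edge into `ℓ`, which lies
one level deeper. -/
theorem nesting_induction (hP : P.WellFormed) {motive : Loc → Prop}
    (step : ∀ ℓ, (∀ e, P.FwdEdge e → e.dst = ℓ →
        (∀ g, P.Encloses g e.src ↔ P.Encloses g e.dst) → motive e.src) →
      (∀ e, P.BackEdge e → e.dst = ℓ → e.src ≠ ℓ → motive e.src) → motive ℓ) (ℓ : Loc) :
    motive ℓ := by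
  let S : Loc → Set Loc := fun ℓ => {g | P.Encloses g ℓ}
  let T : Loc → Set Loc := fun ℓ => {a | Relation.TransGen P.FwdStep a ℓ}
  have hS : ∀ ℓ, S ℓ ⊆ P.L := fun ℓ g hg => by
    obtain ⟨e, he, rfl⟩ := hg.isHead
    exact (hP.edges_mem e he.1).2
  have hT : ∀ ℓ, T ℓ ⊆ P.L := fun ℓ a ha => by
    obtain ⟨b, ⟨e, he, rfl, -⟩, -⟩ := Relation.TransGen.head'_iff.1 ha
    exact (hP.edges_mem e he.1).1
  have hSle : ∀ ℓ, (S ℓ).ncard ≤ (P.L : Set Loc).ncard := fun ℓ =>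
    Set.ncard_le_ncard (hS ℓ) P.L.finite_toSet
  -- deeper locations come first, and on one level the order is topological
  induction ℓ using (InvImage.wf (fun ℓ => ((P.L : Set Loc).ncard - (S ℓ).ncard, (T ℓ).ncard))
    (WellFounded.prod_lex Nat.lt_wfRel.wf Nat.lt_wfRel.wf)).induction with
  | _ ℓ ih =>
    refine step ℓ (fun e he hd hc => ih _ ?_) (fun e he hd hs => ih _ ?_)
    · subst hd
      have h₁ : S e.src = S e.dst := Set.ext hc
      have hst : P.FwdStep e.src e.dst := ⟨e, he, rfl, rfl⟩
      have h₂ : (T e.src).ncard < (T e.dst).ncard := by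
        refine Set.ncard_lt_ncard ⟨fun a ha => Relation.TransGen.tail ha hst, fun hsub => ?_⟩
          (P.L.finite_toSet.subset (hT _))
        exact hP.fwd_acyclic e.src (hsub (Relation.TransGen.single hst))
      simp only [InvImage, h₁]
      exact Prod.Lex.right _ h₂
    · subst hd
      have h₁ : (S e.dst).ncard < (S e.src).ncard := by
        refine Set.ncard_lt_ncard ⟨fun a ha => he.encloses_src hP ha, fun hsub => ?_⟩
          (P.L.finite_toSet.subset (hS _))
        exact (hsub (he.innermost hP hs).1).2 rfl
      have h₂ := hSle e.src
      exact Prod.Lex.left _ _ (Nat.sub_lt_sub_left (h₁.trans_le h₂) h₁)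

/-- One step of dependency in the encodings of `P`, for arbitrary iterations. -/
def DependsOn (P : Program Loc Stmt) (m n : Nm Loc Stmt A) : Prop :=
  ∃ c : Comp Loc Stmt A, P.Encoded c ∧ m ∈ c.srcs ∧ c.dest = n

/-- Forward flow never ends in an iterate that results from widening. -/
theorem entryName_ne_succ {h ℓ : Loc} (hh : P.IsHead h) {o p : List ℕ} {i : ℕ} :
    (P.entryName ℓ o : Nm Loc Stmt A) ≠ .cell h (p ++ [i + 1]) := by
  intro he
  by_cases hl : P.IsHead ℓ
  · rw [entryName_of_isHead hl] at he
    have := (List.append_inj' (Nm.cell_inj he).2 rfl).2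
    simp at this
  · rw [entryName_of_not_isHead hl] at he
    exact hl ((Nm.cell_inj he).1 ▸ hh)

/-- Forward flow never ends in the fixed-point cell of a loop head. -/
theorem entryName_ne_fix (hP : P.WellFormed) {h ℓ : Loc} (hh : P.IsHead h) {o p : List ℕ}
    (ho : P.AnyCtx ℓ o) (hp : P.AnyCtx h p) :
    (P.entryName ℓ o : Nm Loc Stmt A) ≠ .cell h p := by
  intro he
  by_cases hl : P.IsHead ℓ
  · rw [entryName_of_isHead hl] at he
    obtain ⟨rfl, rfl⟩ := Nm.cell_inj he
    exact ho.append_false hP hp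
  · rw [entryName_of_not_isHead hl] at he
    exact hl ((Nm.cell_inj he).1 ▸ hh)

theorem Encoded.dest_ne_edge {c : Comp Loc Stmt A} (hc : P.Encoded c) {a b : Loc} :
    c.dest ≠ .prod (.loc a) (.loc b) := by
  intro h
  cases hc with
  | transfer => exact entryName_ne_prod h
  | preJoin => simp at h
  | join => exact entryName_ne_prod h
  | back => simp at h
  | widen => simp at h
  | fix => exact Nm.cell_ne_prod h

theorem Encoded.dest_ne_joinEdge {c : Comp Loc Stmt A} (hc : P.Encoded c) {i : ℕ} {a b : Loc} :
    c.dest ≠ .prod (.int i) (.prod (.loc a) (.loc b)) := by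
  intro h
  cases hc with
  | transfer => exact entryName_ne_prod h
  | preJoin =>
    simp only [Nm.prod.injEq] at h
    exact entryName_ne_prod h.2
  | join => exact entryName_ne_prod h
  | back => simp at h
  | widen => simp at h
  | fix => exact Nm.cell_ne_prod h

/-- `n` has no infinite descending chain of dependencies. -/
abbrev Accessible (P : Program Loc Stmt) (A : Type*) (n : Nm Loc Stmt A) : Prop := Acc P.DependsOn n

theorem acc_of_encoded {n : Nm Loc Stmt A}
    (h : ∀ c, P.Encoded c → c.dest = n → ∀ m ∈ c.srcs, P.Accessible A m) : P.Accessible A n :=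
  ⟨n, fun _ ⟨c, hc, hm, hn⟩ => h c hc hn _ hm⟩

theorem acc_edge (a b : Loc) : P.Accessible A (.prod (.loc a) (.loc b)) :=
  acc_of_encoded fun _ hc h => (hc.dest_ne_edge h).elim

theorem acc_joinEdge (i : ℕ) (a b : Loc) :
    P.Accessible A (.prod (.int i) (.prod (.loc a) (.loc b))) :=
  acc_of_encoded fun _ hc h => (hc.dest_ne_joinEdge h).elim

theorem acc_preJoin {ℓ : Loc} {o : List ℕ} (i : ℕ)
    (h : ∀ e, P.FwdEdge e → e.dst = ℓ → P.Accessible A (.cell e.src o)) :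
    P.Accessible A (.prod (.int i) (P.entryName ℓ o)) := by
  refine acc_of_encoded fun c hc hn m hm => ?_
  cases hc with
  | transfer => exact (entryName_ne_prod hn).elim
  | preJoin hj he ho =>
    simp only [Nm.prod.injEq] at hn
    obtain ⟨rfl, rfl⟩ := entryName_inj hn.2
    obtain ⟨he, hd⟩ := fwdEdgesTo_getElem? he
    simp only [List.mem_cons, List.not_mem_nil, or_false] at hm
    rcases hm with rfl | rfl
    exacts [acc_joinEdge _ _ _, h _ he hd]
  | join => exact (entryName_ne_prod hn).elim
  | back => simp at hn
  | widen => simp at hn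
  | fix => exact (Nm.cell_ne_prod hn).elim

theorem acc_entryName (hP : P.WellFormed) {ℓ : Loc} {o : List ℕ} (ho : P.AnyCtx ℓ o)
    (h : ∀ e, P.FwdEdge e → e.dst = ℓ → P.Accessible A (.cell e.src o)) :
    P.Accessible A (P.entryName ℓ o) := by
  refine acc_of_encoded fun c hc hn m hm => ?_
  cases hc with
  | transfer he =>
    obtain ⟨rfl, rfl⟩ := entryName_inj hn
    simp only [List.mem_cons, List.not_mem_nil, or_false] at hm
    rcases hm with rfl | rfl
    exacts [acc_edge _ _, h _ he rfl]
  | preJoin => exact (entryName_ne_prod hn.symm).elim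
  | join =>
    obtain ⟨rfl, rfl⟩ := entryName_inj hn
    obtain ⟨i, -, rfl⟩ := List.mem_map.1 hm
    exact acc_preJoin _ h
  | back => exact (entryName_ne_prod hn.symm).elim
  | widen hh =>
    dsimp only at hn
    rw [← Nm.cell_append] at hn
    exact (entryName_ne_succ hh hn.symm).elim
  | fix hh ho' => exact (entryName_ne_fix hP hh ho ho' hn.symm).elim

theorem acc_preWiden {h : Loc} {o : List ℕ} {i : ℕ}
    (hs : ∀ e, P.BackEdge e → e.dst = h → P.Accessible A (.cell e.src (o ++ [i]))) :
    P.Accessible A (.prod (.cell h (o ++ [i])) (.cell h (o ++ [i + 1]))) := by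
  refine acc_of_encoded fun c hc hn m hm => ?_
  cases hc with
  | transfer => exact (entryName_ne_prod hn).elim
  | preJoin => simp [Nm.cell_append] at hn
  | join => exact (entryName_ne_prod hn).elim
  | back he =>
    simp only [Nm.cell_append, Nm.prod.injEq, Nm.iter.injEq] at hn
    obtain ⟨⟨hn, rfl⟩, -⟩ := hn
    obtain ⟨rfl, rfl⟩ := Nm.cell_inj hn
    simp only [List.mem_cons, List.not_mem_nil, or_false] at hm
    rcases hm with rfl | rfl
    exacts [acc_edge _ _, hs _ he rfl]
  | widen => simp at hn
  | fix => exact (Nm.cell_ne_prod hn).elim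

theorem acc_iterate_succ (hP : P.WellFormed) {h : Loc} (hh : P.IsHead h) {o : List ℕ}
    (ho : P.AnyCtx h o) {i : ℕ} (hi : P.Accessible A (.cell h (o ++ [i])))
    (hs : ∀ e, P.BackEdge e → e.dst = h → P.Accessible A (.cell e.src (o ++ [i]))) :
    P.Accessible A (.cell h (o ++ [i + 1])) := by
  refine acc_of_encoded fun c hc hn m hm => ?_
  cases hc with
  | transfer => exact (entryName_ne_succ hh hn).elim
  | preJoin => exact (Nm.cell_ne_prod hn.symm).elim
  | join => exact (entryName_ne_succ hh hn).elim
  | back => exact (Nm.cell_ne_prod hn.symm).elim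
  | widen =>
    simp only [Nm.cell_append, Nm.iter.injEq, add_left_inj] at hn
    obtain ⟨hn, rfl⟩ := hn
    obtain ⟨rfl, rfl⟩ := Nm.cell_inj hn
    simp only [List.mem_cons, List.not_mem_nil, or_false, ← Nm.cell_append] at hm
    rcases hm with rfl | rfl
    exacts [hi, acc_preWiden hs]
  | fix _ ho' =>
    obtain ⟨rfl, rfl⟩ := Nm.cell_inj hn
    exact (ho.append_false hP ho').elim

theorem acc_fix (hP : P.WellFormed) {h : Loc} (hh : P.IsHead h) {o : List ℕ}
    (ho : P.AnyCtx h o) (hi : ∀ i, P.Accessible A (.cell h (o ++ [i]))) :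
    P.Accessible A (.cell h o) := by
  refine acc_of_encoded fun c hc hn m hm => ?_
  cases hc with
  | transfer _ _ ho' => exact (entryName_ne_fix hP hh ho' ho hn).elim
  | preJoin => exact (Nm.cell_ne_prod hn.symm).elim
  | join _ ho' => exact (entryName_ne_fix hP hh ho' ho hn).elim
  | back => exact (Nm.cell_ne_prod hn.symm).elim
  | widen _ ho' =>
    dsimp only at hn
    rw [← Nm.cell_append] at hn
    obtain ⟨rfl, rfl⟩ := Nm.cell_inj hn
    exact (AnyCtx.append_false hP ho' ho).elim
  | fix =>
    obtain ⟨rfl, rfl⟩ := Nm.cell_inj hn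
    simp only [List.mem_cons, List.not_mem_nil, or_false, ← Nm.cell_append] at hm
    rcases hm with rfl | rfl
    exacts [hi _, hi _]

/-- The cells at `ℓ` are accessible once the iterate is that starts the surrounding pass over the
body of the loop around `ℓ`. -/
theorem acc_cell_of_base (hP : P.WellFormed) (ℓ : Loc) : ∀ o, P.AnyCtx ℓ o →
    (∀ h, P.Innermost h ℓ → P.Accessible A (.cell h o)) →
    P.Accessible A (.cell ℓ o) ∧ (P.IsHead ℓ → ∀ i, P.Accessible A (.cell ℓ (o ++ [i]))) := by
  induction ℓ using nesting_induction hP with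
  | step ℓ ihf ihb =>
    intro o ho hbase
    have hentry : P.Accessible A (P.entryName ℓ o) := by
      refine acc_entryName hP ho fun e he hd => ?_
      rcases he.enclosing hP with hc | hi
      · refine (ihf e he hd hc o (.congr (fun g => (hc g).symm) (hd ▸ ho)) fun h hi => ?_).1
        exact hbase h (hd ▸ (innermost_congr hc).1 hi)
      · exact hbase _ (hd ▸ hi)
    by_cases hh : P.IsHead ℓ
    · have hit : ∀ i, P.Accessible A (.cell ℓ (o ++ [i])) := by
        intro i
        induction i with
        | zero => rwa [← entryName_of_isHead hh]
        | succ i ih =>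
          refine acc_iterate_succ hP hh ho ih fun e he hd => ?_
          by_cases hs : e.src = ℓ
          · rwa [hs]
          · have hi : P.Innermost ℓ e.src := hd ▸ he.innermost hP (hd ▸ hs)
            refine (ihb e he hd hs _ (.inner hi ho trivial) fun h hi' => ?_).1
            rwa [hi'.unique hP hi]
      exact ⟨acc_fix hP hh ho hit, fun _ => hit⟩
    · exact ⟨by rwa [← entryName_of_not_isHead hh], fun hh' => (hh hh').elim⟩

theorem acc_cell (hP : P.WellFormed) {ℓ : Loc} {o : List ℕ} (ho : P.AnyCtx ℓ o) :
    P.Accessible A (.cell ℓ o) ∧ (P.IsHead ℓ → ∀ i, P.Accessible A (.cell ℓ (o ++ [i]))) := by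
  induction ho with
  | top hn => exact acc_cell_of_base hP _ _ (.top hn) fun h hi => (hn h hi.1).elim
  | @inner h ℓ o i hi ho _ ih =>
    refine acc_cell_of_base hP _ _ (.inner hi ho trivial) fun h' hi' => ?_
    obtain rfl := hi.unique hP hi'
    exact ih.2 hi.1.isHead i

theorem acc_fwd_source (hP : P.WellFormed) {e : Edge Loc Stmt} (he : P.FwdEdge e) {o : List ℕ}
    (ho : P.AnyCtx e.dst o) : P.Accessible A (.cell e.src o) := by
  rcases he.enclosing hP with hc | hi
  · exact (acc_cell hP (.congr (fun g => (hc g).symm) ho)).1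
  · obtain ⟨p, i, rfl, hp⟩ := ho.of_innermost hP hi
    exact (acc_cell hP hp).2 hi.1.isHead i

theorem acc_back_source (hP : P.WellFormed) {e : Edge Loc Stmt} (he : P.BackEdge e) {o : List ℕ}
    (ho : P.AnyCtx e.dst o) (i : ℕ) : P.Accessible A (.cell e.src (o ++ [i])) := by
  by_cases hs : e.src = e.dst
  · rw [hs]
    exact (acc_cell hP ho).2 he.isHead i
  · exact (acc_cell hP (.inner (he.innermost hP hs) ho trivial)).1

/-- The dependencies are well-founded although a fixed-point cell depends on all iterates. -/
theorem dependsOn_wf (hP : P.WellFormed) : WellFounded (P.DependsOn (A := A)) := by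
  refine ⟨fun n => acc_of_encoded fun c hc _ m hm => ?_⟩
  cases hc with
  | transfer he _ ho =>
    simp only [List.mem_cons, List.not_mem_nil, or_false] at hm
    rcases hm with rfl | rfl
    exacts [acc_edge _ _, acc_fwd_source hP he ho]
  | preJoin _ he ho =>
    obtain ⟨he', rfl⟩ := fwdEdgesTo_getElem? he
    simp only [List.mem_cons, List.not_mem_nil, or_false] at hm
    rcases hm with rfl | rfl
    exacts [acc_joinEdge _ _ _, acc_fwd_source hP he' ho]
  | join _ ho =>
    obtain ⟨i, -, rfl⟩ := List.mem_map.1 hm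
    exact acc_preJoin _ fun e he hd => acc_fwd_source hP he (hd ▸ ho)
  | back he ho =>
    simp only [List.mem_cons, List.not_mem_nil, or_false] at hm
    rcases hm with rfl | rfl
    exacts [acc_edge _ _, acc_back_source hP he ho _]
  | widen hh ho =>
    simp only [List.mem_cons, List.not_mem_nil, or_false, ← Nm.cell_append] at hm
    rcases hm with rfl | rfl
    exacts [(acc_cell hP ho).2 hh _,
      acc_preWiden fun e he hd => acc_back_source hP he (hd ▸ ho) _]
  | fix hh ho =>
    simp only [List.mem_cons, List.not_mem_nil, or_false, ← Nm.cell_append] at hm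
    rcases hm with rfl | rfl
    exacts [(acc_cell hP ho).2 hh _, (acc_cell hP ho).2 hh _]

end Program

end Demanded

namespace Demanded

/-! ### Unrolling -/

namespace Nm

variable {Loc Stmt A : Type*}

/-- The state name whose location and counts determine those of `n`: the second factor of a
product, and `n` itself otherwise. -/
def target : Nm Loc Stmt A → Nm Loc Stmt A
  | prod _ b => b
  | n => n

theorem target_cell (ℓ : Loc) (o : List ℕ) :
    (cell ℓ o : Nm Loc Stmt A).target = cell ℓ o := by
  rcases List.eq_nil_or_concat o with rfl | ⟨q, j, rfl⟩
  · rfl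
  · simp [List.concat_eq_append, cell_append, target]

theorem incr_iter_cell (d : ℕ) (ℓ : Loc) (o : List ℕ) (i : ℕ) :
    (iter (cell ℓ o) i : Nm Loc Stmt A).incr d =
      if o.length = d then iter (cell ℓ o) (i + 1) else iter (cell ℓ (o.modify d (· + 1))) i := by
  rw [incr, primes_cell, incr_cell]

end Nm

namespace Program

variable {Loc Stmt A : Type*} {P : Program Loc Stmt}

theorem target_entryName (ℓ : Loc) (o : List ℕ) :
    (P.entryName ℓ o : Nm Loc Stmt A).target = P.entryName ℓ o := by
  obtain ⟨p, hp⟩ := exists_entryName_eq_cell (P := P) (Stmt := Stmt) (A := A) ℓ o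
  rw [hp, Nm.target_cell]

theorem incr_entryName {d : ℕ} {ℓ : Loc} {o : List ℕ} (h : d < o.length) :
    (P.entryName ℓ o : Nm Loc Stmt A).incr d = P.entryName ℓ (o.modify d (· + 1)) := by
  unfold entryName
  split_ifs with hh
  · rw [Nm.incr_iter_cell, if_neg h.ne']
  · rw [Nm.incr_cell]

/-- The states computed in iteration `k` of the loop of `h` within the iterations `o`: those in the
body of the loop, and the iterate `k + 1` in which the iteration results. -/
def InRegion (P : Program Loc Stmt) (h : Loc) (o : List ℕ) (k : ℕ) (n : Nm Loc Stmt A) : Prop :=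
  ∃ ℓ p, n = .cell ℓ p ∧ ((P.Encloses h ℓ ∧ o ++ [k] <+: p) ∨ (ℓ = h ∧ p = o ++ [k + 1]))

theorem prefix_of_prefix_append {p q : List ℕ} {i j : ℕ} (h : p ++ [i] <+: q ++ [j])
    (hl : p.length < q.length) : p ++ [i] <+: q :=
  List.prefix_of_prefix_length_le h (List.prefix_append _ _) (by simpa using hl)

theorem InRegion.entryName_inv (hP : P.WellFormed) {h ℓ : Loc} {o p : List ℕ} {k : ℕ}
    (ho : P.AnyCtx h o) (hp : P.AnyCtx ℓ p)
    (hr : P.InRegion h o k (P.entryName ℓ p : Nm Loc Stmt A)) :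
    P.Encloses h ℓ ∧ o ++ [k] <+: p := by
  obtain ⟨ℓ', q, hn, hr⟩ := hr
  by_cases hh : P.IsHead ℓ
  · rw [entryName_of_isHead hh] at hn
    obtain ⟨rfl, rfl⟩ := Nm.cell_inj hn
    rcases hr with ⟨he, hr⟩ | ⟨rfl, hr⟩
    · exact ⟨he, prefix_of_prefix_append hr (ho.length_lt hP hp he)⟩
    · have := (List.append_inj' hr rfl).2
      simp at this
  · rw [entryName_of_not_isHead hh] at hn
    obtain ⟨rfl, rfl⟩ := Nm.cell_inj hn
    rcases hr with hr | ⟨rfl, rfl⟩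
    · exact hr
    · exact (ho.append_false hP hp).elim

theorem InRegion.iterate_inv (hP : P.WellFormed) {h g : Loc} {o p : List ℕ} {k i : ℕ}
    (ho : P.AnyCtx h o) (hp : P.AnyCtx g p)
    (hr : P.InRegion h o k (.cell g (p ++ [i + 1]) : Nm Loc Stmt A)) :
    (P.Encloses h g ∧ o ++ [k] <+: p) ∨ (g = h ∧ p = o ∧ i = k) := by
  obtain ⟨ℓ', q, hn, hr⟩ := hr
  obtain ⟨rfl, rfl⟩ := Nm.cell_inj hn
  rcases hr with ⟨he, hr⟩ | ⟨rfl, hr⟩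
  · exact .inl ⟨he, prefix_of_prefix_append hr (ho.length_lt hP hp he)⟩
  · obtain ⟨rfl, hi⟩ := List.append_inj' hr rfl
    simp only [List.cons.injEq, add_left_inj, and_true] at hi
    exact .inr ⟨rfl, rfl, hi⟩

theorem InRegion.fix_inv (hP : P.WellFormed) {h g : Loc} {o p : List ℕ} {k : ℕ}
    (ho : P.AnyCtx h o) (hp : P.AnyCtx g p)
    (hr : P.InRegion h o k (.cell g p : Nm Loc Stmt A)) :
    P.Encloses h g ∧ o ++ [k] <+: p := by
  obtain ⟨ℓ', q, hn, hr⟩ := hr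
  obtain ⟨rfl, rfl⟩ := Nm.cell_inj hn
  rcases hr with hr | ⟨rfl, rfl⟩
  · exact hr
  · exact (ho.append_false hP hp).elim

theorem length_lt_of_prefix {o p : List ℕ} {k : ℕ} (h : o ++ [k] <+: p) :
    o.length < p.length := by
  simpa using h.length_le

/-- The source of a forward edge into the body of a loop lies in the same iteration, or is the
iterate from which this iteration starts. -/
theorem fwd_source_region (hP : P.WellFormed) {h : Loc} {e : Edge Loc Stmt} (he : P.FwdEdge e)
    {o p : List ℕ} {k : ℕ} (ho : P.AnyCtx h o) (hp : P.AnyCtx e.dst p)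
    (hr : P.Encloses h e.dst ∧ o ++ [k] <+: p) :
    P.InRegion h o k (.cell e.src p : Nm Loc Stmt A) ∨ e.src = h ∧ p = o ++ [k] := by
  by_cases hs : e.src = h
  · rcases he.enclosing hP with hc | hi
    · exact ((((hc h).2 hr.1).2 hs).elim)
    · obtain ⟨q, i, rfl, hq⟩ := hp.of_innermost hP hi
      subst hs
      exact .inr ⟨rfl, (hr.2.eq_of_length (by simp [ho.length_eq hP hq])).symm⟩
  · exact .inl ⟨_, _, rfl, .inl ⟨he.encloses_src hP hr.1 hs, hr.2⟩⟩

/-- Every dependency of a state in the region of iteration `k` is in this region, or is the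
iterate `k` from which the iteration starts, or is not computed at all. -/
theorem Encoded.region_step (hP : P.WellFormed) {h : Loc} {o : List ℕ} {k : ℕ}
    (ho : P.AnyCtx h o) {c : Comp Loc Stmt A} (hc : P.Encoded c)
    (hr : P.InRegion h o k c.dest.target) {m : Nm Loc Stmt A} (hm : m ∈ c.srcs) :
    P.InRegion h o k m.target ∨ m = .cell h (o ++ [k]) ∨
      ∀ c' : Comp Loc Stmt A, P.Encoded c' → c'.dest ≠ m := by
  cases hc with
  | transfer he _ hp =>
    rw [target_entryName] at hr
    simp only [List.mem_cons, List.not_mem_nil, or_false] at hm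
    rcases hm with rfl | rfl
    · exact .inr (.inr fun c' hc' => hc'.dest_ne_edge)
    · rcases fwd_source_region (A := A) hP he ho hp (hr.entryName_inv hP ho hp) with h | ⟨rfl, rfl⟩
      · exact .inl (by rwa [Nm.target_cell])
      · exact .inr (.inl rfl)
  | preJoin _ he hp =>
    obtain ⟨he', rfl⟩ := fwdEdgesTo_getElem? he
    simp only [Nm.target] at hr
    simp only [List.mem_cons, List.not_mem_nil, or_false] at hm
    rcases hm with rfl | rfl
    · exact .inr (.inr fun c' hc' => hc'.dest_ne_joinEdge)
    · rcases fwd_source_region (A := A) hP he' ho hp (hr.entryName_inv hP ho hp) with h | ⟨rfl, rfl⟩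
      · exact .inl (by rwa [Nm.target_cell])
      · exact .inr (.inl rfl)
  | join =>
    rw [target_entryName] at hr
    obtain ⟨i, -, rfl⟩ := List.mem_map.1 hm
    exact .inl hr
  | @back e p i he hp =>
    simp only [Nm.target, ← Nm.cell_append] at hr
    simp only [List.mem_cons, List.not_mem_nil, or_false] at hm
    rcases hm with rfl | rfl
    · exact .inr (.inr fun c' hc' => hc'.dest_ne_edge)
    · rw [Nm.target_cell]
      rcases hr.iterate_inv hP ho hp with ⟨h₁, h₂⟩ | ⟨rfl, rfl, rfl⟩
      · exact .inl ⟨_, _, rfl, .inl ⟨he.encloses_src hP h₁, h₂.trans (List.prefix_append _ _)⟩⟩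
      · by_cases hs : e.src = e.dst
        · exact .inr (.inl (by rw [hs]))
        · exact .inl ⟨_, _, rfl, .inl ⟨(he.innermost hP hs).1, List.prefix_rfl⟩⟩
  | @widen g p i _ hp =>
    simp only [Nm.target, ← Nm.cell_append] at hr
    simp only [List.mem_cons, List.not_mem_nil, or_false, ← Nm.cell_append] at hm
    rcases hm with rfl | rfl
    · rw [Nm.target_cell]
      rcases hr.iterate_inv hP ho hp with ⟨h₁, h₂⟩ | ⟨rfl, rfl, rfl⟩
      · exact .inl ⟨_, _, rfl, .inl ⟨h₁, h₂.trans (List.prefix_append _ _)⟩⟩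
      · exact .inr (.inl rfl)
    · exact .inl hr
  | fix _ hp =>
    dsimp only at hr
    rw [Nm.target_cell] at hr
    obtain ⟨h₁, h₂⟩ := hr.fix_inv hP ho hp
    simp only [List.mem_cons, List.not_mem_nil, or_false, ← Nm.cell_append] at hm
    rcases hm with rfl | rfl <;> rw [Nm.target_cell] <;>
      exact .inl ⟨_, _, rfl, .inl ⟨h₁, h₂.trans (List.prefix_append _ _)⟩⟩

/-- Everything that is computed between the iterates `k` and `k + 1` belongs to iteration `k`. -/
theorem Encoded.inRegion (hP : P.WellFormed) {h : Loc} {o : List ℕ} {k : ℕ}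
    (ho : P.AnyCtx h o) {c : Comp Loc Stmt A} (hc : P.Encoded c)
    (h₁ : Relation.TransGen P.DependsOn (.cell h (o ++ [k])) c.dest)
    (h₂ : Relation.ReflTransGen P.DependsOn c.dest (.cell h (o ++ [k + 1]))) :
    P.InRegion h o k c.dest.target := by
  have key : ∀ m : Nm Loc Stmt A, Relation.ReflTransGen P.DependsOn m (.cell h (o ++ [k + 1])) →
      P.InRegion h o k m.target ∨ Relation.ReflTransGen P.DependsOn m (.cell h (o ++ [k])) ∨
        ∀ c' : Comp Loc Stmt A, P.Encoded c' → c'.dest ≠ m := by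
    intro m hm
    induction hm using Relation.ReflTransGen.head_induction_on with
    | refl => exact .inl ⟨_, _, Nm.target_cell _ _, .inr ⟨rfl, rfl⟩⟩
    | head hmn _ ih =>
      obtain ⟨c', hc', hm, rfl⟩ := id hmn
      rcases ih with ih | ih | ih
      · rcases hc'.region_step hP ho ih hm with h | rfl | h
        exacts [.inl h, .inr (.inl .refl), .inr (.inr h)]
      · exact .inr (.inl (ih.head hmn))
      · exact (ih c' hc' rfl).elim
  -- a state computed from the iterate `k` cannot precede it, since dependencies are acyclic
  rcases key _ h₂ with h | h | h
  · exact h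
  · exact ((dependsOn_wf hP).transGen.irrefl.irrefl _ (h₁.trans_left h)).elim
  · exact (h c hc rfl).elim

theorem AnyCtx.modify {ℓ : Loc} {o : List ℕ} (h : P.AnyCtx ℓ o) (d : ℕ) (f : ℕ → ℕ) :
    P.AnyCtx ℓ (o.modify d f) :=
  h.of_length_eq (List.length_modify ..)

/-- Incrementing the iteration count of a loop turns the computations of one iteration into those
of the next. -/
theorem Encoded.incr (hP : P.WellFormed) {h : Loc} {o : List ℕ} {k : ℕ}
    (ho : P.AnyCtx h o) {c : Comp Loc Stmt A} (hc : P.Encoded c)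
    (hr : P.InRegion h o k c.dest.target) : P.Encoded (c.incr o.length) := by
  cases hc with
  | transfer he hj hp =>
    rw [target_entryName] at hr
    have hl := length_lt_of_prefix (hr.entryName_inv hP ho hp).2
    simp only [Comp.incr, List.map_cons, List.map_nil, incr_entryName hl, Nm.incr, Nm.incr_cell]
    exact .transfer he hj (AnyCtx.modify hp _ _)
  | preJoin hj he hp =>
    simp only [Nm.target] at hr
    have hl := length_lt_of_prefix (hr.entryName_inv hP ho hp).2
    simp only [Comp.incr, List.map_cons, List.map_nil, Nm.incr, incr_entryName hl, Nm.incr_cell]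
    exact .preJoin hj he (AnyCtx.modify hp _ _)
  | join hj hp =>
    rw [target_entryName] at hr
    have hl := length_lt_of_prefix (hr.entryName_inv hP ho hp).2
    simp only [Comp.incr, List.map_map, Function.comp_def, Nm.incr, incr_entryName hl]
    exact .join hj (AnyCtx.modify hp _ _)
  | @back e p i he hp =>
    simp only [Nm.target, ← Nm.cell_append] at hr
    simp only [Comp.incr, List.map_cons, List.map_nil, Nm.incr.eq_2, Nm.cell_append,
      Nm.incr_iter_cell]
    rcases hr.iterate_inv hP ho hp with ⟨h₁, h₂⟩ | ⟨rfl, rfl, rfl⟩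
    · simp only [if_neg (length_lt_of_prefix h₂).ne', ← Nm.cell_append e.src]
      exact .back he (AnyCtx.modify hp _ _) trivial
    · simp only [if_true, ← Nm.cell_append e.src]
      exact .back he hp trivial
  | widen hh hp =>
    simp only [Nm.target, ← Nm.cell_append] at hr
    simp only [Comp.incr, List.map_cons, List.map_nil, Nm.incr.eq_2, Nm.incr_iter_cell]
    rcases hr.iterate_inv hP ho hp with ⟨h₁, h₂⟩ | ⟨rfl, rfl, rfl⟩
    · simp only [if_neg (length_lt_of_prefix h₂).ne']
      exact .widen hh (AnyCtx.modify hp _ _) trivial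
    · simp only [if_true]
      exact .widen hh hp trivial
  | fix hh hp =>
    dsimp only at hr
    rw [Nm.target_cell] at hr
    have hl := length_lt_of_prefix (hr.fix_inv hP ho hp).2
    simp only [Comp.incr, List.map_cons, List.map_nil, Nm.incr_cell, Nm.incr_iter_cell,
      if_neg hl.ne']
    exact .fix hh (AnyCtx.modify hp _ _) trivial

end Program

namespace DAIG

variable {Loc Stmt A : Type*} {P : Program Loc Stmt} {D : DAIG Loc Stmt A}

theorem Reach.dependsOn (hD : ∀ c ∈ D.C, P.Encoded c) {m n : Nm Loc Stmt A} (h : D.Reach m n) :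
    Relation.TransGen P.DependsOn m n :=
  Relation.TransGen.mono (fun _ _ ⟨c, hc, hm, hn⟩ => ⟨c, hD c hc, hm, hn⟩) _ _ h

/-- Unrolling a loop adds only computations that encode the program. -/
theorem unroll_encoded (hP : P.WellFormed) (hD : ∀ c ∈ D.C, P.Encoded c) {n : Nm Loc Stmt A}
    {k : ℕ} (hn : P.Encoded ⟨n, .fix, [n.iter k, n.iter (k + 1)]⟩) :
    ∀ c ∈ (D.unroll n k).C, P.Encoded c := by
  cases hn with
  | @fix h o _ hh ho =>
    rintro c ((hc | rfl) | ⟨c', hc', h₁, h₂, rfl⟩)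
    · exact hD c hc.1
    · exact .fix hh ho trivial
    · rw [Nm.primes_cell]
      simp only [← Nm.cell_append] at h₁ h₂
      refine (hD c' hc').incr hP ho ((hD c' hc').inRegion hP ho (h₁.dependsOn hD) ?_)
      rcases h₂ with h₂ | h₂
      · rw [h₂]
      · exact (h₂.dependsOn hD).to_reflTransGen

end DAIG

/-! ### Soundness of queries -/

section

variable {Loc Stmt A : Type*} [SemilatticeSup A] [OrderBot A]
  {P : Program Loc Stmt} {I : AbstractInterpreter Stmt A}

/-- The invariant of query evaluation: all computations encode the program, and all stored values
are those of the batch analysis.  The uniqueness of cell names is not part of it: unrolling may add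
an empty copy of a cell that is already present. -/
structure DAIG.Faithful (P : Program Loc Stmt) (I : AbstractInterpreter Stmt A)
    (D : DAIG Loc Stmt A) : Prop where
  encoded : ∀ c ∈ D.C, P.Encoded c
  denotes : ∀ r ∈ D.R, ∀ v, r.val = some v → Denotes P I r.name v

theorem DAIG.Faithful.write {D : DAIG Loc Stmt A} (hD : D.Faithful P I) {n : Nm Loc Stmt A}
    {v : Val Stmt A} (hv : Denotes P I n v) : (D.write n v).Faithful P I := by
  refine ⟨hD.encoded, ?_⟩
  rintro _ ⟨r, hr, rfl⟩ w hw
  dsimp only at hw ⊢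
  split_ifs at hw ⊢ with h
  · rw [← Option.some.inj hw]
    exact h ▸ hv
  · exact hD.denotes r hr w hw

theorem DAIG.Faithful.unroll (hP : P.WellFormed) {D : DAIG Loc Stmt A} (hD : D.Faithful P I)
    {n : Nm Loc Stmt A} {k : ℕ} (hn : P.Encoded ⟨n, .fix, [n.iter k, n.iter (k + 1)]⟩) :
    (D.unroll n k).Faithful P I := by
  refine ⟨DAIG.unroll_encoded hP hD.encoded hn, ?_⟩
  rintro r (hr | ⟨m, -, -, rfl⟩) v hv
  · exact hD.denotes r hr v hv
  · cases hv

/-- A consistent DAIG stores the values of the batch analysis, by well-founded induction along the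
computations. -/
theorem DAIG.faithful (hP : P.WellFormed) {D : DAIG Loc Stmt A} (hD : D.WellFormed)
    (hCfg : D.CfgConsistent P) (hAI : D.AIConsistent P I) : D.Faithful P I := by
  refine ⟨hCfg.only_comps, fun r hr => ?_⟩
  generalize hn : r.name = n
  induction n using (Program.dependsOn_wf hP).induction generalizing r with
  | _ n ih =>
    subst hn
    intro v hv
    rcases hCfg.only_cells r hr with hs | ⟨ht, hn | ⟨c, hc, hn⟩⟩
    · exact .stmt hs hv
    · obtain rfl := hD.names_unique _ hr _ hAI.init_mem hn
      rw [← Option.some.inj hv]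
      exact .init
    · obtain ⟨name, ty, val⟩ := r
      obtain ⟨dest, f, ns⟩ := c
      dsimp only at hv hn ht
      subst hv hn ht
      obtain ⟨vs, hvs, hy⟩ := hAI.results _ v hr f ns hc
      refine Denotes.of_encoded hP (hCfg.only_comps _ hc) ?_ hy
      refine List.forall₂_iff_get.2 ⟨hvs.length_eq, fun i h₁ h₂ => ?_⟩
      obtain ⟨τ, hm⟩ := hvs.get h₁ h₂
      exact ih _ ⟨_, hCfg.only_comps _ hc, List.get_mem _ _, rfl⟩ _ hm rfl _ rfl

open Classical in
theorem Memo.Sound.update {M : Memo Loc Stmt A} (hM : M.Sound I) {f : Fn}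
    {vs : List (Val Stmt A)} {φ : A} (h : I.Yields f vs (.state φ)) :
    Memo.Sound (Function.update M (.memo f vs) (some φ)) I := by
  intro g ws ψ hψ
  by_cases he : (Nm.memo g ws : Nm Loc Stmt A) = .memo f vs
  · obtain ⟨rfl, rfl⟩ := Nm.memo_inj he
    rw [Function.update_self] at hψ
    exact Option.some.inj hψ ▸ h
  · rw [Function.update_of_ne he] at hψ
    exact hM g ws ψ hψ

theorem Query.sound (hP : P.WellFormed) {D D' : DAIG Loc Stmt A} {M M' : Memo Loc Stmt A}
    {n : Nm Loc Stmt A} {v : Val Stmt A} (hQ : Query I D M n v D' M') :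
    D.Faithful P I → M.Sound I → Denotes P I n v ∧ D'.Faithful P I ∧ M'.Sound I := by
  -- the queries of the sources, one after the other
  have thread : ∀ (D : ℕ → DAIG Loc Stmt A) (M : ℕ → Memo Loc Stmt A) (ns : List (Nm Loc Stmt A))
      (vs : Fin ns.length → Val Stmt A),
      (∀ i : Fin ns.length, (D i).Faithful P I → (M i).Sound I →
        Denotes P I ns[i] (vs i) ∧ (D (i + 1)).Faithful P I ∧ (M (i + 1)).Sound I) →
      (D 0).Faithful P I → (M 0).Sound I →
      List.Forall₂ (Denotes P I) ns (List.ofFn vs) ∧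
        (D ns.length).Faithful P I ∧ (M ns.length).Sound I := by
    intro D M ns vs ih hD hM
    have key : ∀ j ≤ ns.length, (D j).Faithful P I ∧ (M j).Sound I := by
      intro j hj
      induction j with
      | zero => exact ⟨hD, hM⟩
      | succ j ihj =>
        obtain ⟨h₁, h₂⟩ := ihj (by omega)
        exact (ih ⟨j, by omega⟩ h₁ h₂).2
    refine ⟨List.forall₂_iff_get.2 ⟨by simp, fun i h₁ h₂ => ?_⟩, key _ le_rfl⟩
    obtain ⟨h₃, h₄⟩ := key i h₁.le
    simpa using (ih ⟨i, h₁⟩ h₃ h₄).1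
  induction hQ with
  | reuse h => exact fun hD hM => ⟨hD.denotes _ h _ rfl, hD, hM⟩
  | found _ hc _ hm ih =>
    intro hD hM
    obtain ⟨hs, hD', hM'⟩ := thread _ _ _ _ ih hD hM
    have := Denotes.of_encoded hP (hD.encoded _ hc) hs (hM' _ _ _ hm)
    exact ⟨this, hD'.write this, hM'⟩
  | @miss D M n τ f ns vs φ _ hc _ _ hf hφ ih =>
    intro hD hM
    obtain ⟨hs, hD', hM'⟩ := thread _ _ _ _ ih hD hM
    have hy : I.Yields f (List.ofFn vs) (.state φ) := by
      cases f
      case fix => exact (hf rfl).elim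
      all_goals exact ⟨_, hφ, rfl⟩
    have := Denotes.of_encoded hP (hD.encoded _ hc) hs hy
    exact ⟨this, hD'.write this, hM'.update hy⟩
  | converge _ hc _ _ ih₁ ih₂ =>
    intro hD hM
    obtain ⟨h₁, hD', hM'⟩ := ih₁ hD hM
    obtain ⟨h₂, hD'', hM''⟩ := ih₂ hD' hM'
    have := Denotes.of_encoded hP (hD.encoded _ hc) (.cons h₁ (.cons h₂ .nil)) rfl
    exact ⟨this, hD''.write this, hM''⟩
  | unroll _ hc _ _ _ _ ih₁ ih₂ ih₃ =>
    intro hD hM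
    obtain ⟨-, hD', hM'⟩ := ih₁ hD hM
    obtain ⟨-, hD'', hM''⟩ := ih₂ hD' hM'
    exact ih₃ (hD''.unroll hP (hD.encoded _ hc)) hM''

end

end Demanded

theorem mainTheorem1 {Loc Stmt A : Type*} [SemilatticeSup A] [OrderBot A]
    (P : Demanded.Program Loc Stmt) (hP : P.WellFormed)
    (I : Demanded.AbstractInterpreter Stmt A)
    (M : Demanded.Memo Loc Stmt A) (hM : M.Sound I)
    (D : Demanded.DAIG Loc Stmt A) (hD : D.WellFormed)
    (hCfg : D.CfgConsistent P) (hAI : D.AIConsistent P I)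
    (ℓ : Loc) (v : Demanded.Val Stmt A)
    (D' : Demanded.DAIG Loc Stmt A) (M' : Demanded.Memo Loc Stmt A)
    (hQ : Demanded.Query I D M (.loc ℓ) v D' M') :
    ∃ φ, v = .state φ ∧ ∀ ψ, Demanded.GlobalInvariant P I ℓ ψ ↔ ψ = φ := by
  have hv : Demanded.Denotes P I (.cell ℓ []) v :=
    (hQ.sound hP (Demanded.DAIG.faithful hP hD hCfg hAI) hM).1
  rcases hv.cell_inv with ⟨hd, φ, rfl, h, hb⟩ | ⟨p, i, _, _, _, hp, _⟩
  · generalize ho : ([] : List ℕ) = o at h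
    cases h with
    | top => exact ⟨φ, rfl, fun ψ => ⟨fun h => h.unique hP hb, fun h => h ▸ hb⟩⟩
    | inner => simp at ho
  · simp at hp
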